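/- Let $\mathfrak g$ be a finite-dimensional complex semisimple Lie algebra, $\mathfrak h\subset\mathfrak g$ a Cartan subalgebra, $\alpha_1,\dots,\alpha_n$ a choice of simple roots, and $D$ a subset of the simple roots (a subdiagram of the Dynkin diagram). Let $\mathfrak g_D\subseteq\mathfrak g$ be the Lie subalgebra generated by the root vectors $e_\alpha,f_\alpha$ with $\alpha\in D$, $R_D$ its root system (the roots of $\mathfrak g$ whose root space lies in $\mathfrak g_D$), $\mathfrak l_D=\mathfrak g_D+\mathfrak h$ the corresponding Levi subalgebra, and $\mathfrak c_D$ the centre of $\mathfrak l_D$. Let $\mathfrak n_D^{+}$ and $\mathfrak n_D^{-}$ be the spans of the root vectors $e_\alpha$, respectively $f_\alpha$, with $\alpha$ ranging over the positive roots of $\mathfrak g$ not in $R_D$. Let $k\ge 1$. For $y\in\mathfrak g$ and $1\le i\le k$ put $y_i=1^{\otimes(i-1)}\otimes y\otimes 1^{\otimes(k-i)}\in U\mathfrak g^{\otimes k}$; an element $x\in\mathfrak g$ acts on $U\mathfrak g^{\otimes k}$ by the adjoint action $\operatorname{ad}(x)u=[\sum_i x_i,u]$, and $(U\mathfrak g^{\otimes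 k})^{\mathfrak c_D}$ is the subalgebra of elements killed by $\operatorname{ad}(\mathfrak c_D)$. Set $$I_k=(U\mathfrak g^{\otimes k})^{\mathfrak c_D}\cap\sum_{i=1}^k U\mathfrak g^{\otimes k}\cdot(\mathfrak n_D^{+})_i .$$ Then: 1. $I_k=(U\mathfrak g^{\otimes k})^{\mathfrak c_D}\cap\sum_{i=1}^k(\mathfrak n_D^{-})_i\cdot U\mathfrak g^{\otimes k}$. 2. $I_k$ is a two-sided ideal in $(U\mathfrak g^{\otimes k})^{\mathfrak c_D}$, and it is invariant under the adjoint action of $\mathfrak l_D$. 3. The canonical homomorphism $U\mathfrak l_D^{\otimes k}\to U\mathfrak g^{\otimes k}$ is injective and, identifying $U\mathfrak l_D^{\otimes k}$ with its image, $(U\mathfrak g^{\otimes k})^{\mathfrak c_D}=I_k\oplus U\mathfrak l_D^{\otimes k}$. 4. Consequently, the adjoint action of $\mathfrak l_D$ preserves $(U\mathfrak g^{\otimes k})^{\mathfrak c_D}$, and there is a unique $\mathfrak l_D$-equivariant algebra homomorphism $\pi_D^k:(U\mathfrak g^{\otimes k})^{\mathfrak c_D}\to U\mathfrak l_D^{\otimes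 k}$ (the generalised Harish-Chandra homomorphism) with kernel $I_k$ that restricts to the identity on $U\mathfrak l_D^{\otimes k}$. -/

import Mathlib

open scoped TensorProduct

namespace GenHC

open LieAlgebra LieAlgebra.IsKilling

noncomputable section

attribute [local instance 100] LieRing.ofAssociativeRing

section RootData

variable {g : Type*} [LieRing g] [LieAlgebra ℂ g] [FiniteDimensional ℂ g]
  [LieAlgebra.IsSemisimple ℂ g] (H : LieSubalgebra ℂ g) [H.IsCartanSubalgebra]

/-- The diagrammatic subalgebra `g_D`: the Lie subalgebra generated by the root vectors
`e_α, f_α` with `α ∈ D`. -/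
def diagSubalgebra (D : Set H.root) : LieSubalgebra ℂ g :=
  LieSubalgebra.lieSpan ℂ g
    {x : g | ∃ α ∈ D, x ∈ rootSpace H (α.1 : H → ℂ) ∨ x ∈ rootSpace H (-(α.1 : H → ℂ))}

/-- The root system `R_D` of `g_D`: the roots of `g` whose root space lies in `g_D`. -/
def diagRoots (D : Set H.root) : Set H.root :=
  {α | ∀ x ∈ rootSpace H (α.1 : H → ℂ), x ∈ diagSubalgebra H D}

set_option linter.unusedSectionVars false in
/-- A Lie bracket of an element of the Cartan subalgebra with an element of `g_D` lies
in `g_D`. -/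
theorem cartan_lie_mem (D : Set H.root) {h x : g} (hh : h ∈ H)
    (hx : x ∈ diagSubalgebra H D) : ⁅h, x⁆ ∈ diagSubalgebra H D := by
  induction hx using LieSubalgebra.lieSpan_induction with
  | mem x hx =>
    obtain ⟨α, hα, hx | hx⟩ := hx
    · exact LieSubalgebra.subset_lieSpan
        ⟨α, hα, Or.inl ((rootSpace H (α.1 : H → ℂ)).lie_mem (x := (⟨h, hh⟩ : H)) hx)⟩
    · exact LieSubalgebra.subset_lieSpan
        ⟨α, hα, Or.inr ((rootSpace H (-(α.1 : H → ℂ))).lie_mem (x := (⟨h, hh⟩ : H)) hx)⟩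
  | zero => simp
  | add x y _ _ hx hy => rw [lie_add]; exact add_mem hx hy
  | smul a x _ hx => rw [lie_smul]; exact (diagSubalgebra H D).smul_mem a hx
  | lie x y hx' hy' hx hy =>
    rw [leibniz_lie]
    exact add_mem ((diagSubalgebra H D).lie_mem hx hy') ((diagSubalgebra H D).lie_mem hx' hy)

/-- The Levi subalgebra `l_D = g_D + h`. -/
def levi (D : Set H.root) : LieSubalgebra ℂ g where
  __ := (diagSubalgebra H D).toSubmodule ⊔ H.toSubmodule
  lie_mem' := by
    intro x y hx hy
    obtain ⟨x₁, hx₁, x₂, hx₂, rfl⟩ := Submodule.mem_sup.1 hx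
    obtain ⟨y₁, hy₁, y₂, hy₂, rfl⟩ := Submodule.mem_sup.1 hy
    refine Submodule.mem_sup.2 ⟨⁅x₁, y₁⁆ + ⁅x₁, y₂⁆ + ⁅x₂, y₁⁆, ?_, ⁅x₂, y₂⁆,
      H.lie_mem hx₂ hy₂, ?_⟩
    · refine add_mem (add_mem ((diagSubalgebra H D).lie_mem hx₁ hy₁) ?_)
        (cartan_lie_mem H D hx₂ hy₁)
      rw [← lie_skew]
      exact neg_mem (cartan_lie_mem H D hy₂ hx₁)
    · simp only [lie_add, add_lie]
      abel

/-- The centre `c_D` of the Levi subalgebra `l_D`, as a subspace of `g`. -/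
def leviCenter (D : Set H.root) : Submodule ℂ g :=
  (LieAlgebra.center ℂ (levi H D)).toSubmodule.map (levi H D).toSubmodule.subtype

variable {H}

/-- The subalgebra `n_D⁺` (as a subspace of `g`), spanned by the root vectors `e_α`, where `α` is
a positive root not in `R_D`. -/
def nPlus (b : (rootSystem H).Base) (D : Set H.root) : Submodule ℂ g :=
  Submodule.span ℂ
    {x : g | ∃ α : H.root, b.IsPos α ∧ α ∉ diagRoots H D ∧ x ∈ rootSpace H (α.1 : H → ℂ)}

/-- The subalgebra `n_D⁻` (as a subspace of `g`), spanned by the root vectors `f_α`, where `α` is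
a positive root not in `R_D`. -/
def nMinus (b : (rootSystem H).Base) (D : Set H.root) : Submodule ℂ g :=
  Submodule.span ℂ
    {x : g | ∃ α : H.root, b.IsPos α ∧ α ∉ diagRoots H D ∧ x ∈ rootSpace H (-(α.1 : H → ℂ))}

end RootData

section Tensor

variable (k : ℕ) (g : Type*) [LieRing g] [LieAlgebra ℂ g]

/-- The algebra `U(g)^{⊗ k}`. -/
abbrev UTensor : Type _ := ⨂[ℂ] _ : Fin k, UniversalEnvelopingAlgebra ℂ g

variable {k g}

/-- For `y ∈ g`, the element `y_i = 1 ⊗ ⋯ ⊗ y ⊗ ⋯ ⊗ 1` with `y` in position `i`. -/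
def slot (i : Fin k) : g →ₗ[ℂ] UTensor k g :=
  (PiTensorProduct.singleAlgHom (R := ℂ)
    (A := fun _ : Fin k => UniversalEnvelopingAlgebra ℂ g) i).toLinearMap ∘ₗ
    (UniversalEnvelopingAlgebra.ι ℂ : g →ₗ⁅ℂ⁆ UniversalEnvelopingAlgebra ℂ g).toLinearMap

variable (k) in
/-- The image `∑ i, x_i` of `x ∈ g` under the iterated coproduct `U(g) → U(g)^{⊗ k}`. -/
def diagonal : g →ₗ[ℂ] UTensor k g := ∑ i : Fin k, slot i

/-- The (diagonal) adjoint action of `g` on `U(g)^{⊗ k}`: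
`ad x (u₁ ⊗ ⋯ ⊗ uₖ) = ∑ i, u₁ ⊗ ⋯ ⊗ [x, uᵢ] ⊗ ⋯ ⊗ uₖ`, which is the commutator with
`∑ i, x_i`. -/
def adAct (x : g) (u : UTensor k g) : UTensor k g := diagonal k x * u - u * diagonal k x

variable (k) in
/-- The subalgebra `(U(g)^{⊗ k})^c` of invariants under the adjoint action of `c ⊆ g`. -/
def invariants (c : Submodule ℂ g) : Subalgebra ℂ (UTensor k g) where
  carrier := {u | ∀ z ∈ c, adAct z u = 0}
  mul_mem' := by
    intro u v hu hv z hz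
    have hu' := sub_eq_zero.1 (hu z hz)
    have hv' := sub_eq_zero.1 (hv z hz)
    simp only [adAct]
    rw [← mul_assoc, hu', mul_assoc, hv', mul_assoc, sub_self]
  add_mem' := by
    intro u v hu hv z hz
    have hu' := sub_eq_zero.1 (hu z hz)
    have hv' := sub_eq_zero.1 (hv z hz)
    simp only [adAct]
    rw [mul_add, add_mul, hu', hv', sub_self]
  algebraMap_mem' := by
    intro r z _
    simp only [adAct]
    rw [Algebra.commutes, sub_self]

variable (k) in
/-- The left ideal `∑ i, U(g)^{⊗ k} · n_i`. -/
def leftSum (n : Submodule ℂ g) : Submodule ℂ (UTensor k g) :=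
  ⨆ i : Fin k, Submodule.span ℂ {w | ∃ u : UTensor k g, ∃ y ∈ n, w = u * slot i y}

variable (k) in
/-- The right ideal `∑ i, n_i · U(g)^{⊗ k}`. -/
def rightSum (n : Submodule ℂ g) : Submodule ℂ (UTensor k g) :=
  ⨆ i : Fin k, Submodule.span ℂ {w | ∃ u : UTensor k g, ∃ y ∈ n, w = slot i y * u}

variable (k) in
/-- The canonical algebra homomorphism `U(l)^{⊗ k} → U(g)^{⊗ k}` for a Lie subalgebra `l ⊆ g`. -/
def inclTensor (l : LieSubalgebra ℂ g) : UTensor k l →ₐ[ℂ] UTensor k g :=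
  PiTensorProduct.liftAlgHom
    ((PiTensorProduct.tprod ℂ).compLinearMap fun _ : Fin k =>
      (UniversalEnvelopingAlgebra.lift ℂ
        ((UniversalEnvelopingAlgebra.ι ℂ : g →ₗ⁅ℂ⁆ UniversalEnvelopingAlgebra ℂ g).comp
          l.incl)).toLinearMap)
    (by
      simp only [MultilinearMap.compLinearMap_apply, Pi.one_apply, AlgHom.toLinearMap_apply,
        map_one]
      rfl)
    (by
      intro x y
      simp only [MultilinearMap.compLinearMap_apply, Pi.mul_apply, AlgHom.toLinearMap_apply,
        map_mul]
      exact (PiTensorProduct.tprod_mul_tprod _ _).symm)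

end Tensor

section HarishChandra

variable {g : Type*} [LieRing g] [LieAlgebra ℂ g] [FiniteDimensional ℂ g]
  [LieAlgebra.IsSemisimple ℂ g] {H : LieSubalgebra ℂ g} [H.IsCartanSubalgebra]

/-- `I_k = (U(g)^{⊗ k})^{c_D} ∩ ∑ i, U(g)^{⊗ k} · (n_D⁺)_i`. -/
def hcIdeal (k : ℕ) (b : (rootSystem H).Base) (D : Set H.root) : Submodule ℂ (UTensor k g) :=
  Subalgebra.toSubmodule (invariants k (leviCenter H D)) ⊓ leftSum k (nPlus b D)

end HarishChandra

end

end GenHC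

namespace GenHC

open LieAlgebra LieAlgebra.IsKilling

noncomputable section

attribute [local instance 100] LieRing.ofAssociativeRing

/-! ### Enveloping algebras: generation and induction -/

section Enveloping

variable {K A : Type*} [CommRing K] [Ring A] [Algebra K A]

/-! Everything is controlled by one element `z` of the Cartan subalgebra, on which the simple roots
in `D` vanish and the other simple roots equal 1. It lies in `c_D`, and `ad z` has weight zero on
`l_D`, positive integral weights on `n_D⁺` and negative integral weights on `n_D⁻`. Hence `g = n_D⁻
+ l_D + n_D⁺` is a triangular decomposition, and every `c_D`-invariant tensor has weight zero under
`z`.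

Two facts are played against each other. The first is an upper bound: a weight-zero element lies in
the subalgebra generated by `l_D` plus the right ideal of `n_D⁻`, and likewise in that subalgebra
plus the left ideal of `n_D⁺` (`eigenspace_zero_le_sup_rightIdeal`,
`eigenspace_zero_le_sup_leftIdeal`). Reordering products leaves, modulo the right ideal, only
products from `l_D + n_D⁺`; those involving `n_D⁺` have positive weight and cannot contribute.

The second is independence: a linear retraction of `U(l_D) → U(g)` kills both `n_D⁻ U(g)` and `U(g)
n_D⁺`. Instead of a Poincaré–Birkhoff–Witt basis, `exists_action` constructs the induced module on
`U(n_D⁻) ⊗ U(l_D)`; applying `u` to `1 ⊗ 1` and then the augmentation of `U(n_D⁻)` gives the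
retraction. Its tensor power is `r`.

Together, for invariant `u`, the difference of `u` and `r u` lies in both one-sided ideals. So `I_k`
is the kernel of `r` on the invariants, has both descriptions, is a left ideal by one and a right
ideal by the other, and `r` is multiplicative there. -/

/-- A submodule containing `1` and stable under left multiplication by the elements of `X` contains
the subalgebra generated by `X`. -/
theorem adjoin_le_of_mul_mem_left {X : Set A} {S : Submodule K A} (h1 : 1 ∈ S)
    (hX : ∀ x ∈ X, ∀ s ∈ S, x * s ∈ S) : Subalgebra.toSubmodule (Algebra.adjoin K X) ≤ S := by
  intro c hc
  suffices h : ∀ s ∈ S, c * s ∈ S by simpa using h 1 h1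
  induction hc using Algebra.adjoin_induction with
  | mem x hx => exact hX x hx
  | algebraMap r => intro s hs; rw [← Algebra.smul_def]; exact S.smul_mem r hs
  | add x y _ _ hx hy => intro s hs; rw [add_mul]; exact add_mem (hx s hs) (hy s hs)
  | mul x y _ _ hx hy => intro s hs; rw [mul_assoc]; exact hx _ (hy s hs)

/-- A submodule containing `1` and stable under right multiplication by the elements of `X`
contains the subalgebra generated by `X`. -/
theorem adjoin_le_of_mul_mem_right {X : Set A} {S : Submodule K A} (h1 : 1 ∈ S)
    (hX : ∀ x ∈ X, ∀ s ∈ S, s * x ∈ S) : Subalgebra.toSubmodule (Algebra.adjoin K X) ≤ S := by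
  intro c hc
  suffices h : ∀ s ∈ S, s * c ∈ S by simpa using h 1 h1
  induction hc using Algebra.adjoin_induction with
  | mem x hx => exact hX x hx
  | algebraMap r =>
    intro s hs; rw [← Algebra.commutes, ← Algebra.smul_def]; exact S.smul_mem r hs
  | add x y _ _ hx hy => intro s hs; rw [mul_add]; exact add_mem (hx s hs) (hy s hs)
  | mul x y _ _ hx hy => intro s hs; rw [← mul_assoc]; exact hy _ (hx s hs)

variable {a : Type*} [LieRing a] [LieAlgebra K a]

/-- The universal enveloping algebra is generated by the Lie algebra. -/
theorem adjoin_range_ι :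
    Algebra.adjoin K (Set.range (UniversalEnvelopingAlgebra.ι K (L := a))) = ⊤ := by
  set S := Algebra.adjoin K (Set.range (UniversalEnvelopingAlgebra.ι K (L := a)))
  let j : a →ₗ⁅K⁆ S :=
    { toFun := fun x => ⟨UniversalEnvelopingAlgebra.ι K x, Algebra.subset_adjoin ⟨x, rfl⟩⟩
      map_add' := fun x y => Subtype.ext (map_add _ x y)
      map_smul' := fun r x => Subtype.ext (map_smul _ r x)
      map_lie' := fun {x y} => Subtype.ext
        (LieHom.map_lie (UniversalEnvelopingAlgebra.ι K) x y) }
  -- By the universal property, the identity factors through the subalgebra `S`, which is therefore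
  -- everything.
  have h : S.val.comp (UniversalEnvelopingAlgebra.lift K j) = AlgHom.id K _ := by
    ext x
    simp only [LieHom.comp_apply, AlgHom.coe_toLieHom, AlgHom.comp_apply,
      UniversalEnvelopingAlgebra.lift_ι_apply]
    rfl
  rw [eq_top_iff]
  intro u _
  have hu := DFunLike.congr_fun h u
  rw [AlgHom.comp_apply, AlgHom.id_apply] at hu
  rw [← hu]
  exact (UniversalEnvelopingAlgebra.lift K j u).2

theorem env_induction {p : UniversalEnvelopingAlgebra K a → Prop} (one : p 1)
    (add : ∀ u v, p u → p v → p (u + v)) (smul : ∀ (r : K) u, p u → p (r • u))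
    (ι_mul : ∀ x u, p u → p (UniversalEnvelopingAlgebra.ι K x * u)) (u) : p u := by
  let S : Submodule K (UniversalEnvelopingAlgebra K a) :=
    { carrier := {u | p u}
      add_mem' := fun {x y} => add x y
      zero_mem' := by simpa using smul 0 1 one
      smul_mem' := smul }
  refine adjoin_le_of_mul_mem_left (S := S) one ?_
    (show u ∈ Algebra.adjoin K (Set.range (UniversalEnvelopingAlgebra.ι K (L := a))) by
      rw [adjoin_range_ι]; trivial)
  rintro _ ⟨x, rfl⟩ s hs
  exact ι_mul x s hs

end Enveloping

/-! ### The induced module on `U(a) ⊗ B` and the projection to `U(l)` -/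

section MatchedPair

variable {K g a B : Type*} [CommRing K] [LieRing g] [LieAlgebra K g] [LieRing a] [LieAlgebra K a]
  [Ring B] [Algebra K B]

local notation "U" => UniversalEnvelopingAlgebra

/-- The action of a Lie algebra `a`, mapping to `g`, on linear maps from `g` to an
`U(a)`-module. -/
def coindAct (j : a →ₗ⁅K⁆ g) (M : Type*) [AddCommGroup M] [Module K M] [Module (U K a) M]
    [IsScalarTower K (U K a) M] : a →ₗ⁅K⁆ Module.End K (g →ₗ[K] M) where
  toFun y :=
    { toFun := fun φ => (Algebra.lsmul K K M (UniversalEnvelopingAlgebra.ι K y)) ∘ₗ φ -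
        φ ∘ₗ (LieAlgebra.ad K g (j y))
      map_add' := fun φ ψ => by ext x; simp; abel
      map_smul' := fun r φ => by
        ext x
        simp only [LinearMap.sub_apply, LinearMap.comp_apply, LinearMap.smul_apply,
          RingHom.id_apply, map_smul, smul_sub] }
  map_add' y y' := by
    ext φ x
    simp only [map_add, LinearMap.add_comp, LinearMap.comp_add, LinearMap.coe_mk, AddHom.coe_mk,
      LinearMap.add_apply, LinearMap.sub_apply]
    abel
  map_smul' r y := by
    ext φ x
    simp only [map_smul, LinearMap.smul_comp, LinearMap.comp_smul, LinearMap.coe_mk, AddHom.coe_mk,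
      LinearMap.smul_apply, LinearMap.sub_apply, RingHom.id_apply, smul_sub]
  map_lie' {y y'} := by
    ext φ x
    simp only [LieHom.map_lie, LieRing.of_associative_ring_bracket, LinearMap.coe_mk,
      AddHom.coe_mk, LinearMap.sub_apply, LinearMap.comp_apply, Module.End.mul_apply, map_sub,
      map_mul, LieAlgebra.ad_apply]
    abel

theorem coindAct_apply (j : a →ₗ⁅K⁆ g) (M : Type*) [AddCommGroup M] [Module K M]
    [Module (U K a) M] [IsScalarTower K (U K a) M] (y : a) (φ : g →ₗ[K] M) (x : g) :
    coindAct j M y φ x = UniversalEnvelopingAlgebra.ι K y • φ x - φ ⁅j y, x⁆ := rfl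

variable (j : a →ₗ⁅K⁆ g) (pa : g →ₗ[K] a) (σ : g →ₗ[K] B)

/-- The initial values `x ↦ p_a(x) ⊗ b + 1 ⊗ σ(x) b` of the action of `g` on `U(a) ⊗ B`. -/
def initAct : B →ₗ[K] g →ₗ[K] (U K a ⊗[K] B) :=
  LinearMap.mk₂ K (fun b x => (UniversalEnvelopingAlgebra.ι K (pa x)) ⊗ₜ[K] b + 1 ⊗ₜ[K] (σ x * b))
    (fun b b' x => by simp only [TensorProduct.tmul_add, mul_add]; abel)
    (fun r b x => by simp)
    (fun b x x' => by simp only [map_add, TensorProduct.add_tmul, add_mul, TensorProduct.tmul_add]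
                      abel)
    (fun r b x => by
      simp only [map_smul, smul_mul_assoc, TensorProduct.tmul_smul, smul_add,
        TensorProduct.smul_tmul'])

/-- The action of `g` on `U(a) ⊗ B`, as a linear map. -/
def prodAct : g →ₗ[K] Module.End K (U K a ⊗[K] B) :=
  LinearMap.flip (TensorProduct.lift
    ((LinearMap.lcomp K (g →ₗ[K] (U K a ⊗[K] B)) (initAct pa σ)) ∘ₗ
      (UniversalEnvelopingAlgebra.lift K (coindAct j (U K a ⊗[K] B))).toLinearMap))

theorem prodAct_tmul (x : g) (u : U K a) (b : B) : prodAct j pa σ x (u ⊗ₜ b) =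
    UniversalEnvelopingAlgebra.lift K (coindAct j (U K a ⊗[K] B)) u (initAct pa σ b) x := rfl

theorem prodAct_one_tmul (x : g) (b : B) : prodAct j pa σ x (1 ⊗ₜ b) =
    (UniversalEnvelopingAlgebra.ι K (pa x)) ⊗ₜ[K] b + 1 ⊗ₜ[K] (σ x * b) := by
  rw [prodAct_tmul, map_one]; rfl

/-- This recursion, forced by `x y = y x - [y, x]`, is the reason for `coindAct`: it says that `u ↦
(x ↦ x·(u ⊗ b))` intertwines the actions of `a`, so the universal property of `U(a)` extends it
consistently from its value at `u = 1`. -/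
theorem prodAct_ι_mul_tmul (x : g) (y : a) (u : U K a) (b : B) :
    prodAct j pa σ x ((UniversalEnvelopingAlgebra.ι K y * u) ⊗ₜ b) =
    UniversalEnvelopingAlgebra.ι K y • prodAct j pa σ x (u ⊗ₜ b) -
      prodAct j pa σ ⁅j y, x⁆ (u ⊗ₜ b) := by
  simp only [prodAct_tmul, map_mul, Module.End.mul_apply, UniversalEnvelopingAlgebra.lift_ι_apply,
    coindAct_apply]

variable {j pa σ} (hpa : ∀ s, pa (j s) = s) (hσ : ∀ s, σ (j s) = 0)

-- Consistency check: on `a` itself the recursively defined action must be left multiplication. The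
-- bracket term of the recursion is again in `a`, so induction on `u` closes.
include hpa hσ in
theorem prodAct_left (s : a) (m : U K a ⊗[K] B) :
    prodAct j pa σ (j s) m = UniversalEnvelopingAlgebra.ι K s • m := by
  induction m using TensorProduct.induction_on with
  | zero => simp
  | add m n hm hn => rw [map_add, hm, hn, smul_add]
  | tmul u b =>
    induction u using env_induction generalizing s with
    | one => rw [prodAct_one_tmul, hpa, hσ]; simp [TensorProduct.smul_tmul']
    | add u v hu hv => rw [TensorProduct.add_tmul, map_add, hu, hv, smul_add]
    | smul r u hu => rw [← TensorProduct.smul_tmul', map_smul, hu, smul_comm]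
    | ι_mul y u hu =>
      rw [prodAct_ι_mul_tmul, hu, ← LieHom.map_lie, hu]
      simp only [TensorProduct.smul_tmul', smul_eq_mul, LieHom.map_lie,
        LieRing.of_associative_ring_bracket, ← TensorProduct.sub_tmul]
      congr 1
      noncomm_ring

include hpa hσ in
theorem prodAct_comm_left (x : g) (y : a) (m : U K a ⊗[K] B) :
    prodAct j pa σ x (prodAct j pa σ (j y) m) =
      prodAct j pa σ (j y) (prodAct j pa σ x m) + prodAct j pa σ ⁅x, j y⁆ m := by
  rw [prodAct_left hpa hσ y m, prodAct_left hpa hσ y]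
  induction m using TensorProduct.induction_on with
  | zero => simp
  | add m n hm hn => simp only [map_add, smul_add, hm, hn]; abel
  | tmul u b =>
    rw [TensorProduct.smul_tmul', smul_eq_mul, prodAct_ι_mul_tmul, ← lie_skew x (j y), map_neg,
      LinearMap.neg_apply, sub_eq_add_neg]

variable (hbr : ∀ x x', pa x = 0 → pa x' = 0 →
  pa ⁅x, x'⁆ = 0 ∧ σ ⁅x, x'⁆ = σ x * σ x' - σ x' * σ x)

-- The commutator with an element of `a` is correct by the recursion. Induction on `u` therefore
-- reduces the claim, via the Jacobi identity, to vectors `1 ⊗ b`; there only two elements of `ker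
-- pa` need checking, where `σ` is a Lie homomorphism.
include hpa hσ hbr in
theorem prodAct_lie (x x' : g) (m : U K a ⊗[K] B) :
    prodAct j pa σ ⁅x, x'⁆ m =
      prodAct j pa σ x (prodAct j pa σ x' m) - prodAct j pa σ x' (prodAct j pa σ x m) := by
  have hleft : ∀ x y m, prodAct j pa σ ⁅x, j y⁆ m =
      prodAct j pa σ x (prodAct j pa σ (j y) m) - prodAct j pa σ (j y) (prodAct j pa σ x m) := by
    intro x y m
    rw [prodAct_comm_left hpa hσ]; abel
  induction m using TensorProduct.induction_on with
  | zero => simp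
  | add m n hm hn => simp only [map_add, hm, hn]; abel
  | tmul u b =>
    induction u using env_induction generalizing x x' with
    | one =>
      obtain ⟨q, s, hq, rfl⟩ : ∃ q s, pa q = 0 ∧ x = q + j s := ⟨x - j (pa x), pa x, by simp [hpa],
        by simp⟩
      obtain ⟨q', s', hq', rfl⟩ : ∃ q s, pa q = 0 ∧ x' = q + j s :=
        ⟨x' - j (pa x'), pa x', by simp [hpa], by simp⟩
      have h1 : prodAct j pa σ ⁅q, q'⁆ (1 ⊗ₜ b) = prodAct j pa σ q (prodAct j pa σ q' (1 ⊗ₜ b)) -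
          prodAct j pa σ q' (prodAct j pa σ q (1 ⊗ₜ b)) := by
        simp only [prodAct_one_tmul, hq, hq', hbr q q' hq hq', map_zero, TensorProduct.zero_tmul,
          zero_add, sub_mul, TensorProduct.tmul_sub, mul_assoc]
      have h2 : prodAct j pa σ ⁅j s, q'⁆ (1 ⊗ₜ b) =
          prodAct j pa σ (j s) (prodAct j pa σ q' (1 ⊗ₜ b)) -
          prodAct j pa σ q' (prodAct j pa σ (j s) (1 ⊗ₜ b)) := by
        rw [← lie_skew, map_neg, LinearMap.neg_apply, hleft]; abel
      have h3 : ⁅q + j s, q' + j s'⁆ = ⁅q, q'⁆ + ⁅q, j s'⁆ + (⁅j s, q'⁆ + ⁅j s, j s'⁆) := by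
        rw [add_lie, lie_add, lie_add]
      rw [h3]
      simp only [LinearMap.map_add, LinearMap.add_apply]
      rw [h1, h2, hleft q, hleft (j s)]
      abel
    | add u v hu hv => simp only [TensorProduct.add_tmul, map_add, hu, hv]; abel
    | smul r u hu => simp only [← TensorProduct.smul_tmul', map_smul, hu, smul_sub]
    | ι_mul y u hu =>
      have e : (UniversalEnvelopingAlgebra.ι K y * u) ⊗ₜ[K] b =
          prodAct j pa σ (j y) (u ⊗ₜ b) := by
        rw [prodAct_left hpa hσ]; rfl
      have jac : ⁅⁅x, x'⁆, j y⁆ = ⁅x, ⁅x', j y⁆⁆ - ⁅x', ⁅x, j y⁆⁆ := by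
        rw [lie_lie]
      rw [e]
      simp only [prodAct_comm_left hpa hσ, LinearMap.map_add]
      rw [jac, LinearMap.map_sub, LinearMap.sub_apply, hu x x', hu x ⁅x', j y⁆,
        hu x' ⁅x, j y⁆, LinearMap.map_sub]
      abel

include hpa hσ hbr in
/-- Let `g` be the direct sum, as a module, of a Lie subalgebra `a` and of a Lie subalgebra on
which `σ` is a Lie algebra homomorphism to `B`. Then `g` acts on `U(a) ⊗ B`. -/
theorem exists_action : ∃ Φ : U K g →ₐ[K] Module.End K (U K a ⊗[K] B),
    (∀ s m, Φ (UniversalEnvelopingAlgebra.ι K (j s)) m = UniversalEnvelopingAlgebra.ι K s • m) ∧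
    (∀ x b, pa x = 0 → Φ (UniversalEnvelopingAlgebra.ι K x) (1 ⊗ₜ b) = 1 ⊗ₜ (σ x * b)) := by
  let ρ : g →ₗ⁅K⁆ Module.End K (U K a ⊗[K] B) :=
    { prodAct j pa σ with
      map_lie' := fun {x x'} => LinearMap.ext fun m => prodAct_lie hpa hσ hbr x x' m }
  refine ⟨UniversalEnvelopingAlgebra.lift K ρ, fun s m => ?_, fun x b hx => ?_⟩
  · rw [UniversalEnvelopingAlgebra.lift_ι_apply]
    exact prodAct_left hpa hσ s m
  · rw [UniversalEnvelopingAlgebra.lift_ι_apply]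
    refine (prodAct_one_tmul j pa σ x b).trans ?_
    rw [hx, map_zero, TensorProduct.zero_tmul, zero_add]

/-- The augmentation of an enveloping algebra. -/
def augmentation (K a : Type*) [CommRing K] [LieRing a] [LieAlgebra K a] : U K a →ₐ[K] K :=
  UniversalEnvelopingAlgebra.lift K 0

theorem augmentation_ι (y : a) : augmentation K a (UniversalEnvelopingAlgebra.ι K y) = 0 := by
  rw [augmentation, UniversalEnvelopingAlgebra.lift_ι_apply]; rfl

/-- The inclusion `U(l) → U(g)`. -/
def envIncl (l : LieSubalgebra K g) : U K l →ₐ[K] U K g :=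
  UniversalEnvelopingAlgebra.lift K ((UniversalEnvelopingAlgebra.ι K).comp l.incl)

theorem envIncl_ι (l : LieSubalgebra K g) (x : l) :
    envIncl l (UniversalEnvelopingAlgebra.ι K x) = UniversalEnvelopingAlgebra.ι K (x : g) := by
  rw [envIncl, UniversalEnvelopingAlgebra.lift_ι_apply]; rfl

/-- For a triangular decomposition `g = a ⊕ l ⊕ n` into Lie subalgebras, with `l ⊕ n` a subalgebra
and `n` an ideal in it, the projection of `U(g)` to `U(l)` with kernel `a U(g) + U(g) n`. -/
theorem exists_env_projection (l : LieSubalgebra K g) (j : a →ₗ⁅K⁆ g) (pa : g →ₗ[K] a)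
    (pl : g →ₗ[K] l) (hpa : ∀ s, pa (j s) = s) (hla : ∀ s, pl (j s) = 0)
    (hal : ∀ x : l, pa x = 0) (hll : ∀ x : l, pl x = x)
    (hbr : ∀ x x', pa x = 0 → pa x' = 0 → pa ⁅x, x'⁆ = 0 ∧ pl ⁅x, x'⁆ = ⁅pl x, pl x'⁆) :
    ∃ r : U K g →ₗ[K] U K l, (∀ m, r (envIncl l m) = m) ∧
      (∀ s u, r (UniversalEnvelopingAlgebra.ι K (j s) * u) = 0) ∧
      (∀ x u, pa x = 0 → pl x = 0 → r (u * UniversalEnvelopingAlgebra.ι K x) = 0) := by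
  obtain ⟨Φ, h1, h2⟩ := exists_action (j := j) (pa := pa)
    (σ := ((UniversalEnvelopingAlgebra.ι K : l →ₗ⁅K⁆ U K l) : l →ₗ[K] U K l) ∘ₗ pl) hpa
    (fun s => by simp [hla]) (fun x x' hx hx' => ⟨(hbr x x' hx hx').1, by
      simp only [LinearMap.comp_apply, (hbr x x' hx hx').2, LieHom.coe_toLinearMap,
        LieHom.map_lie, LieRing.of_associative_ring_bracket]⟩)
  -- The projection is `u ↦ ε (u·(1 ⊗ 1))`. The augmentation kills whatever starts with a factor
  -- from `a`, while an element with `pa x = 0` and `pl x = 0` already kills `1 ⊗ 1`.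
  let ε : U K a ⊗[K] U K l →ₗ[K] U K l :=
    (TensorProduct.lid K _).toLinearMap ∘ₗ LinearMap.rTensor _ (augmentation K a).toLinearMap
  have hε : ∀ u v, ε (u ⊗ₜ v) = augmentation K a u • v := fun u v => rfl
  refine ⟨ε ∘ₗ LinearMap.applyₗ (1 ⊗ₜ 1) ∘ₗ Φ.toLinearMap, fun m => ?_, fun s u => ?_,
    fun x u hx hx' => ?_⟩
  · have key : ∀ b, Φ (envIncl l m) (1 ⊗ₜ b) = 1 ⊗ₜ (m * b) := by
      induction m using env_induction with
      | one => simp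
      | add u v hu hv => intro b; simp only [map_add, LinearMap.add_apply, hu, hv, add_mul,
          TensorProduct.tmul_add]
      | smul r u hu => intro b; simp only [map_smul, LinearMap.smul_apply, hu, smul_mul_assoc,
          TensorProduct.tmul_smul]
      | ι_mul x u hu =>
        intro b
        rw [map_mul, map_mul, Module.End.mul_apply, hu, envIncl_ι, h2 _ _ (hal x)]
        simp [hll, mul_assoc]
    change ε (Φ (envIncl l m) (1 ⊗ₜ 1)) = m
    rw [key, hε, map_one, one_smul, mul_one]
  · change ε (Φ (_ * u) (1 ⊗ₜ 1)) = 0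
    rw [map_mul, Module.End.mul_apply, h1]
    induction Φ u (1 ⊗ₜ 1) using TensorProduct.induction_on with
    | zero => simp
    | add m n hm hn => rw [smul_add, map_add, hm, hn, add_zero]
    | tmul u b => rw [TensorProduct.smul_tmul', hε, smul_eq_mul, map_mul, augmentation_ι]; simp
  · change ε (Φ (u * _) (1 ⊗ₜ 1)) = 0
    rw [map_mul, Module.End.mul_apply, h2 _ _ hx]
    simp [hx']

end MatchedPair

/-! ### Weights under an inner grading and one-sided ideals -/

section Weights

variable {K A g ι : Type*} [Field K] [Ring A] [Algebra K A] [LieRing g] [LieAlgebra K g]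

/-- The commutator with `Z` as a linear endomorphism. -/
def commEnd (K : Type*) {A : Type*} [Field K] [Ring A] [Algebra K A] (Z : A) : Module.End K A :=
  LinearMap.mulLeft K Z - LinearMap.mulRight K Z

theorem mem_eigenspace_commEnd {Z u : A} {μ : K} :
    u ∈ (commEnd K Z).eigenspace μ ↔ Z * u - u * Z = μ • u := by
  rw [Module.End.mem_eigenspace_iff]; rfl

theorem mul_mem_eigenspace_commEnd {Z u v : A} {μ ν : K} (hu : u ∈ (commEnd K Z).eigenspace μ)
    (hv : v ∈ (commEnd K Z).eigenspace ν) : u * v ∈ (commEnd K Z).eigenspace (μ + ν) := by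
  rw [mem_eigenspace_commEnd] at *
  calc Z * (u * v) - u * v * Z = (Z * u - u * Z) * v + u * (Z * v - v * Z) := by noncomm_ring
    _ = _ := by rw [hu, hv, smul_mul_assoc, mul_smul_comm, add_smul]

/-- The elements `s i x` with `x` in `L`. -/
def genSet (s : ι → g →ₗ[K] A) (L : Submodule K g) : Set A := {w | ∃ i, ∃ x ∈ L, w = s i x}

/-- The right ideal generated by the elements `s i y` with `y` in `N`. -/
def rightIdeal (s : ι → g →ₗ[K] A) (N : Submodule K g) : Submodule K A :=
  Submodule.span K {w | ∃ i, ∃ y ∈ N, ∃ u, w = s i y * u}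

/-- The left ideal generated by the elements `s i y` with `y` in `N`. -/
def leftIdeal (s : ι → g →ₗ[K] A) (N : Submodule K g) : Submodule K A :=
  Submodule.span K {w | ∃ i, ∃ y ∈ N, ∃ u, w = u * s i y}

theorem mul_mem_rightIdeal {s : ι → g →ₗ[K] A} {N : Submodule K g} {u : A}
    (hu : u ∈ rightIdeal s N) (v : A) : u * v ∈ rightIdeal s N := by
  induction hu using Submodule.span_induction with
  | mem x hx =>
    obtain ⟨i, y, hy, w, rfl⟩ := hx
    exact Submodule.subset_span ⟨i, y, hy, w * v, mul_assoc _ _ _⟩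
  | zero => simp
  | add x y _ _ hx hy => rw [add_mul]; exact add_mem hx hy
  | smul r x _ hx => rw [smul_mul_assoc]; exact Submodule.smul_mem _ r hx

theorem mul_mem_leftIdeal {s : ι → g →ₗ[K] A} {N : Submodule K g} {u : A}
    (hu : u ∈ leftIdeal s N) (v : A) : v * u ∈ leftIdeal s N := by
  induction hu using Submodule.span_induction with
  | mem x hx =>
    obtain ⟨i, y, hy, w, rfl⟩ := hx
    exact Submodule.subset_span ⟨i, y, hy, v * w, (mul_assoc _ _ _).symm⟩
  | zero => simp
  | add x y _ _ hx hy => rw [mul_add]; exact add_mem hx hy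
  | smul r x _ hx => rw [mul_smul_comm]; exact Submodule.smul_mem _ r hx

variable {s : ι → g →ₗ[K] A}
  (hlie : ∀ i x y, s i ⁅x, y⁆ = s i x * s i y - s i y * s i x)
  (hcomm : ∀ i j, i ≠ j → ∀ x y, s i x * s j y = s j y * s i x)
  (hgen : Algebra.adjoin K (genSet s ⊤) = ⊤)

include hlie hcomm hgen in
/-- If `g = P + N`, the elements `s i x` with `x ∈ P` generate a complement to the right ideal
generated by `N`. -/
theorem rightIdeal_sup_adjoin {P N : Submodule K g} (hPN : P ⊔ N = ⊤) :
    rightIdeal s N ⊔ Subalgebra.toSubmodule (Algebra.adjoin K (genSet s P)) = ⊤ := by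
  set T := rightIdeal s N ⊔ Subalgebra.toSubmodule (Algebra.adjoin K (genSet s P))
  have hR : rightIdeal s N ≤ T := le_sup_left
  have hP : Subalgebra.toSubmodule (Algebra.adjoin K (genSet s P)) ≤ T := le_sup_right
  have hs : ∀ i y, s i y ∈ T := by
    intro i y
    obtain ⟨p, hp, n, hn, rfl⟩ := Submodule.mem_sup.1 (show y ∈ P ⊔ N by rw [hPN]; trivial)
    rw [map_add]
    exact add_mem (hP (Algebra.subset_adjoin ⟨i, p, hp, rfl⟩))
      (hR (Submodule.subset_span ⟨i, n, hn, 1, (mul_one _).symm⟩))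
  have hTP : ∀ t ∈ T, ∀ i, ∀ x ∈ P, t * s i x ∈ T := by
    intro t ht i x hx
    obtain ⟨r, hr, p, hp, rfl⟩ := Submodule.mem_sup.1 ht
    rw [add_mul]
    exact add_mem (hR (mul_mem_rightIdeal hr _))
      (hP (Subalgebra.mul_mem _ hp (Algebra.subset_adjoin ⟨i, x, hx, rfl⟩)))
  -- To move an arbitrary `y` leftwards past products from `P`, only the bracket in `g` is used;
  -- neither `P` nor `N` has to be a subalgebra.
  let S : Submodule K A :=
    { carrier := {c | ∀ i y, c * s i y ∈ T}
      add_mem' := fun {c d} hc hd i y => by rw [add_mul]; exact add_mem (hc i y) (hd i y)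
      zero_mem' := fun i y => by rw [zero_mul]; exact zero_mem _
      smul_mem' := fun r c hc i y => by rw [smul_mul_assoc]; exact T.smul_mem r (hc i y) }
  have hPS : Subalgebra.toSubmodule (Algebra.adjoin K (genSet s P)) ≤ S := by
    refine adjoin_le_of_mul_mem_right (fun i y => by rw [one_mul]; exact hs i y) ?_
    rintro _ ⟨j, x, hx, rfl⟩ c hc i y
    rcases eq_or_ne j i with rfl | hij
    · have : c * s j x * s j y = c * s j y * s j x + c * s j ⁅x, y⁆ := by
        rw [hlie]; noncomm_ring
      rw [this]
      exact add_mem (hTP _ (hc j y) j x hx) (hc j _)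
    · rw [mul_assoc, hcomm j i hij, ← mul_assoc]
      exact hTP _ (hc i y) j x hx
  rw [eq_top_iff, ← Algebra.top_toSubmodule, ← hgen]
  refine adjoin_le_of_mul_mem_right (hP (one_mem (Algebra.adjoin K _))) ?_
  rintro _ ⟨i, y, -, rfl⟩ t ht
  obtain ⟨r, hr, p, hp, rfl⟩ := Submodule.mem_sup.1 ht
  rw [add_mul]
  exact add_mem (hR (mul_mem_rightIdeal hr _)) (hPS hp i y)

variable [Fintype ι]

include hlie hcomm in
theorem commutator_diag (z x : g) (i : ι) :
    (∑ j, s j z) * s i x - s i x * (∑ j, s j z) = s i ⁅z, x⁆ := by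
  rw [Finset.sum_mul, Finset.mul_sum, ← Finset.sum_sub_distrib, Finset.sum_eq_single i, hlie]
  · intro j _ hj
    rw [hcomm j i hj, sub_self]
  · simp

include hlie hcomm in
theorem mem_eigenspace_of_lie_eq {z x : g} {μ : K} (hx : ⁅z, x⁆ = μ • x) (i : ι) :
    s i x ∈ (commEnd K (∑ j, s j z)).eigenspace μ := by
  rw [mem_eigenspace_commEnd, commutator_diag hlie hcomm, hx, map_smul]

variable {z : g} {L N Q : Submodule K g} (htop : L ⊔ Q ⊔ N = ⊤) (hL : ∀ x ∈ L, ⁅z, x⁆ = 0)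

include hlie hcomm hL in
theorem adjoin_genSet_le_eigenspace_zero :
    Subalgebra.toSubmodule (Algebra.adjoin K (genSet s L)) ≤
      (commEnd K (∑ j, s j z)).eigenspace 0 := by
  refine adjoin_le_of_mul_mem_right (by rw [mem_eigenspace_commEnd]; simp) ?_
  rintro _ ⟨i, x, hx, rfl⟩ u hu
  simpa using mul_mem_eigenspace_commEnd hu
    (mem_eigenspace_of_lie_eq hlie hcomm (μ := 0) (by rw [hL x hx, zero_smul]) i)

variable (hQ : Q ≤ Submodule.span K {x | ∃ n : ℕ, ⁅z, x⁆ = ((n : K) + 1) • x})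
  (hN : N ≤ Submodule.span K {x | x ∈ N ∧ ∃ μ : K, ⁅z, x⁆ = μ • x})

-- A product of generators from `L` and `Q` either uses `L` only or contains a factor of positive
-- weight; since `L` has weight zero, the total weight is then positive.
include hlie hcomm hL hQ in
theorem adjoin_genSet_sup_le :
    Subalgebra.toSubmodule (Algebra.adjoin K (genSet s (L ⊔ Q))) ≤
      Subalgebra.toSubmodule (Algebra.adjoin K (genSet s L)) ⊔
        ⨆ n : ℕ, (commEnd K (∑ j, s j z)).eigenspace ((n : K) + 1) := by
  set E := (commEnd K (∑ j, s j z)).eigenspace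
  set X := ⨆ n : ℕ, E ((n : K) + 1)
  have hX : ∀ n : ℕ, E ((n : K) + 1) ≤ X := fun n => le_iSup (fun n : ℕ => E ((n : K) + 1)) n
  have hXl : ∀ i, ∀ x ∈ L, ∀ ξ ∈ X, ξ * s i x ∈ X := by
    intro i x hx ξ hξ
    induction hξ using Submodule.iSup_induction' with
    | mem n u hu =>
      refine hX n ?_
      have := mul_mem_eigenspace_commEnd hu
        (mem_eigenspace_of_lie_eq hlie hcomm (μ := 0) (by rw [hL x hx, zero_smul]) i)
      rwa [add_zero] at this
    | zero => simp
    | add u v _ _ hu hv => rw [add_mul]; exact add_mem hu hv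
  have hXq : ∀ i x, ∀ m : ℕ, ⁅z, x⁆ = ((m : K) + 1) • x → ∀ ξ ∈ X, ξ * s i x ∈ X := by
    intro i x m hx ξ hξ
    induction hξ using Submodule.iSup_induction' with
    | mem n u hu =>
      -- The weights `n + 1` and `m + 1` add up to `(n + m + 1) + 1`.
      refine hX (n + m + 1) ?_
      have := mul_mem_eigenspace_commEnd hu (mem_eigenspace_of_lie_eq hlie hcomm hx i)
      convert this using 2
      push_cast; ring
    | zero => simp
    | add u v _ _ hu hv => rw [add_mul]; exact add_mem hu hv
  refine adjoin_le_of_mul_mem_right (Submodule.mem_sup_left (one_mem (Algebra.adjoin K _))) ?_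
  rintro _ ⟨i, x, hx, rfl⟩ t ht
  obtain ⟨x, hxL, y, hy, rfl⟩ := Submodule.mem_sup.1 hx
  obtain ⟨l, hl, ξ, hξ, rfl⟩ := Submodule.mem_sup.1 ht
  rw [map_add, mul_add]
  refine add_mem ?_ ?_
  · rw [add_mul]
    exact add_mem (Submodule.mem_sup_left
      (Subalgebra.mul_mem _ hl (Algebra.subset_adjoin ⟨i, x, hxL, rfl⟩)))
      (Submodule.mem_sup_right (hXl i x hxL ξ hξ))
  · refine Submodule.mem_sup_right ?_
    have hy' := hQ hy
    clear hy ht hx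
    induction hy' using Submodule.span_induction with
    | mem y hy =>
      obtain ⟨n, hn⟩ := hy
      rw [add_mul]
      refine add_mem (hX n ?_) (hXq i y n hn ξ hξ)
      have := mul_mem_eigenspace_commEnd
        (adjoin_genSet_le_eigenspace_zero hlie hcomm hL hl)
        (mem_eigenspace_of_lie_eq hlie hcomm hn i)
      rwa [zero_add] at this
    | zero => simp
    | add x y _ _ hx hy => rw [map_add, mul_add]; exact add_mem hx hy
    | smul r x _ hx => rw [map_smul, mul_smul_comm]; exact X.smul_mem r hx

include hlie hcomm hgen htop hL hQ hN in
theorem iSup_eigenspace_commEnd : ⨆ μ : K, (commEnd K (∑ j, s j z)).eigenspace μ = ⊤ := by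
  set E := (commEnd K (∑ j, s j z)).eigenspace
  have hE : ∀ μ, E μ ≤ ⨆ μ, E μ := fun μ => le_iSup E μ
  have hg : (⊤ : Submodule K g) ≤ Submodule.span K {x | ∃ μ : K, ⁅z, x⁆ = μ • x} := by
    rw [← htop]
    refine sup_le (sup_le (fun x hx => Submodule.subset_span ⟨0, by rw [hL x hx, zero_smul]⟩)
      (hQ.trans (Submodule.span_mono ?_))) (hN.trans (Submodule.span_mono ?_))
    · rintro x ⟨n, hn⟩; exact ⟨_, hn⟩
    · rintro x ⟨-, n, hn⟩; exact ⟨_, hn⟩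
  rw [eq_top_iff, ← Algebra.top_toSubmodule, ← hgen]
  refine adjoin_le_of_mul_mem_right (hE 0 (by rw [mem_eigenspace_commEnd]; simp)) ?_
  rintro _ ⟨i, x, -, rfl⟩ t ht
  have hx := hg (Submodule.mem_top (x := x))
  induction hx using Submodule.span_induction with
  | mem x hx =>
    obtain ⟨μ, hμ⟩ := hx
    induction ht using Submodule.iSup_induction' with
    | mem ν u hu =>
      exact hE _ (mul_mem_eigenspace_commEnd hu (mem_eigenspace_of_lie_eq hlie hcomm hμ i))
    | zero => simp
    | add u v _ _ hu hv => rw [add_mul]; exact add_mem hu hv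
  | zero => simp
  | add x y _ _ hx hy => rw [map_add, mul_add]; exact add_mem hx hy
  | smul r x _ hx => rw [map_smul, mul_smul_comm]; exact Submodule.smul_mem _ r hx

-- A generator `s i y * u` with both factors of pure weight is again of pure weight, so it falls
-- into one of the two summands. The weight-zero part is the only one whose membership in the ideal
-- matters later.
include hlie hcomm hgen htop hL hQ hN in
theorem rightIdeal_le :
    rightIdeal s N ≤ (rightIdeal s N ⊓ (commEnd K (∑ j, s j z)).eigenspace 0) ⊔
      ⨆ μ : K, ⨆ _ : μ ≠ 0, (commEnd K (∑ j, s j z)).eigenspace μ := by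
  have htop' := iSup_eigenspace_commEnd hlie hcomm hgen htop hL hQ hN
  set E := (commEnd K (∑ j, s j z)).eigenspace
  refine Submodule.span_le.2 ?_
  rintro _ ⟨i, y, hy, u, rfl⟩
  rw [SetLike.mem_coe]
  have hy' := hN hy
  clear hy
  induction hy' using Submodule.span_induction with
  | mem y hy =>
    obtain ⟨hyN, μ, hμ⟩ := hy
    have hu : u ∈ ⨆ μ, E μ := by rw [htop']; trivial
    induction hu using Submodule.iSup_induction' with
    | mem ν u hu =>
      have h := mul_mem_eigenspace_commEnd (mem_eigenspace_of_lie_eq hlie hcomm hμ i) hu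
      by_cases h0 : μ + ν = 0
      · rw [h0] at h
        exact Submodule.mem_sup_left ⟨Submodule.subset_span ⟨i, y, hyN, u, rfl⟩, h⟩
      · exact Submodule.mem_sup_right (Submodule.mem_iSup_of_mem (μ + ν)
          (Submodule.mem_iSup_of_mem h0 h))
    | zero => simp
    | add u v _ _ hu hv => rw [mul_add]; exact add_mem hu hv
  | zero => simp
  | add x y _ _ hx hy => rw [map_add, add_mul]; exact add_mem hx hy
  | smul r x _ hx => rw [map_smul, smul_mul_assoc]; exact Submodule.smul_mem _ r hx

variable [CharZero K]

include hlie hcomm hgen htop hL hQ hN in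
/-- The elements of weight zero lie in the sum of the subalgebra generated by `L` and of the right
ideal generated by `N`. -/
theorem eigenspace_zero_le_sup_rightIdeal :
    (commEnd K (∑ j, s j z)).eigenspace 0 ≤
      Subalgebra.toSubmodule (Algebra.adjoin K (genSet s L)) ⊔ rightIdeal s N := by
  intro u hu
  have h1 := rightIdeal_le hlie hcomm hgen htop hL hQ hN
  have h2 := adjoin_genSet_sup_le hlie hcomm hL hQ
  have h3 := adjoin_genSet_le_eigenspace_zero hlie hcomm hL
  have hind := Module.End.eigenspaces_iSupIndep (commEnd K (∑ j, s j z)) 0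
  have hut : u ∈ rightIdeal s N ⊔ Subalgebra.toSubmodule (Algebra.adjoin K (genSet s (L ⊔ Q))) := by
    rw [rightIdeal_sup_adjoin hlie hcomm hgen htop]; trivial
  set E := (commEnd K (∑ j, s j z)).eigenspace
  obtain ⟨r, hr, p, hp, rfl⟩ := Submodule.mem_sup.1 hut
  obtain ⟨r₀, ⟨hr₀, hr₀'⟩, y, hy, rfl⟩ := Submodule.mem_sup.1 (h1 hr)
  obtain ⟨l, hl, ξ, hξ, rfl⟩ := Submodule.mem_sup.1 (h2 hp)
  have hξ' : ξ ∈ ⨆ μ : K, ⨆ _ : μ ≠ 0, E μ :=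
    iSup_le (fun n : ℕ => le_iSup₂_of_le (f := fun (μ : K) (_ : μ ≠ 0) => E μ) ((n : K) + 1)
      (Nat.cast_add_one_ne_zero n) le_rfl) hξ
  -- All other terms of `u` have weight zero, so `y + ξ` has weight zero while being a sum of
  -- elements of nonzero weight.
  have hsum : y + ξ = 0 := by
    refine Submodule.disjoint_def.1 hind _ ?_ (add_mem hy hξ')
    have : y + ξ = (r₀ + y + (l + ξ)) - r₀ - l := by abel
    rw [this]
    exact sub_mem (sub_mem hu hr₀') (h3 hl)
  have : r₀ + y + (l + ξ) = l + r₀ + (y + ξ) := by abel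
  rw [this, hsum, add_zero]
  exact add_mem (Submodule.mem_sup_left hl) (Submodule.mem_sup_right hr₀)

include hlie hcomm hgen hL in
/-- The elements of weight zero lie in the sum of the subalgebra generated by `L` and of the left
ideal generated by `Q`. -/
theorem eigenspace_zero_le_sup_leftIdeal (htop : L ⊔ N ⊔ Q = ⊤)
    (hN : N ≤ Submodule.span K {x | ∃ n : ℕ, ⁅z, x⁆ = -((n : K) + 1) • x})
    (hQ : Q ≤ Submodule.span K {x | x ∈ Q ∧ ∃ μ : K, ⁅z, x⁆ = μ • x}) :
    (commEnd K (∑ j, s j z)).eigenspace 0 ≤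
      Subalgebra.toSubmodule (Algebra.adjoin K (genSet s L)) ⊔ leftIdeal s Q := by
  -- Passing to the opposite algebra exchanges left and right ideals. The sign in `s'` makes it
  -- compatible with brackets again, and replacing `z` by `-z` lets `N` and `Q` exchange roles.
  let o : A ≃ₗ[K] Aᵐᵒᵖ := MulOpposite.opLinearEquiv K
  let s' : ι → g →ₗ[K] Aᵐᵒᵖ := fun i => -(o.toLinearMap ∘ₗ s i)
  have hs' : ∀ i x, s' i x = -MulOpposite.op (s i x) := fun i x => rfl
  have hlie' : ∀ i x y, s' i ⁅x, y⁆ = s' i x * s' i y - s' i y * s' i x := by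
    intro i x y
    simp only [hs', hlie, MulOpposite.op_sub, MulOpposite.op_mul]
    noncomm_ring
  have hcomm' : ∀ i j, i ≠ j → ∀ x y, s' i x * s' j y = s' j y * s' i x := by
    intro i j hij x y
    simp only [hs', neg_mul_neg, ← MulOpposite.op_mul, hcomm i j hij]
  have hadj : ∀ M : Submodule K g, (Subalgebra.toSubmodule (Algebra.adjoin K (genSet s M))).map
      o.toLinearMap ≤ Subalgebra.toSubmodule (Algebra.adjoin K (genSet s' M)) := by
    intro M
    rw [Submodule.map_le_iff_le_comap]
    refine adjoin_le_of_mul_mem_left (one_mem (Algebra.adjoin K (genSet s' M))) ?_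
    rintro _ ⟨i, x, hx, rfl⟩ t ht
    have : o (s i x * t) = o t * -(s' i x) := by rw [hs', neg_neg]; rfl
    change o (s i x * t) ∈ Algebra.adjoin K (genSet s' M)
    rw [this]
    exact mul_mem ht (neg_mem (Algebra.subset_adjoin ⟨i, x, hx, rfl⟩))
  have hadj' : ∀ M : Submodule K g, Subalgebra.toSubmodule (Algebra.adjoin K (genSet s' M)) ≤
      (Subalgebra.toSubmodule (Algebra.adjoin K (genSet s M))).map o.toLinearMap := by
    intro M
    refine adjoin_le_of_mul_mem_right ⟨1, one_mem (Algebra.adjoin K _), rfl⟩ ?_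
    rintro _ ⟨i, x, hx, rfl⟩ _ ⟨t, ht, rfl⟩
    exact ⟨-(s i x) * t, Subalgebra.mul_mem _ (neg_mem (Algebra.subset_adjoin ⟨i, x, hx, rfl⟩)) ht, rfl⟩
  have hgen' : Algebra.adjoin K (genSet s' ⊤) = ⊤ := by
    rw [eq_top_iff]
    intro u _
    exact hadj ⊤ ⟨o.symm u, by rw [hgen]; trivial, rfl⟩
  have hright : rightIdeal s' Q ≤ (leftIdeal s Q).map o.toLinearMap := by
    refine Submodule.span_le.2 ?_
    rintro _ ⟨i, y, hy, u, rfl⟩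
    exact ⟨o.symm u * s i (-y), Submodule.subset_span ⟨i, -y, neg_mem hy, _, rfl⟩, by
      rw [map_neg, mul_neg, map_neg, hs', neg_mul]; rfl⟩
  intro u hu
  have key := eigenspace_zero_le_sup_rightIdeal (z := -z) (L := L) (N := Q) (Q := N) hlie' hcomm'
    hgen' htop (fun x hx => by rw [neg_lie, hL x hx, neg_zero])
    (hN.trans (Submodule.span_mono (by
      rintro x ⟨n, hn⟩
      exact ⟨n, by rw [neg_lie, hn, neg_smul, neg_neg]⟩)))
    (hQ.trans (Submodule.span_mono (by
      rintro x ⟨hx, μ, hμ⟩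
      exact ⟨hx, -μ, by rw [neg_lie, hμ, neg_smul]⟩)))
  have hZ : ∑ j, s' j (-z) = o (∑ j, s j z) := by
    rw [map_sum]
    refine Finset.sum_congr rfl fun j _ => ?_
    rw [hs', map_neg, MulOpposite.op_neg, neg_neg]; rfl
  -- Reversing products negates the commutator, which is harmless for eigenvalue zero.
  have hu' : o u ∈ (commEnd K (∑ j, s' j (-z))).eigenspace 0 := by
    rw [mem_eigenspace_commEnd, zero_smul] at hu ⊢
    rw [hZ]
    have : o (∑ j, s j z) * o u - o u * o (∑ j, s j z) =
      -o ((∑ j, s j z) * u - u * (∑ j, s j z)) := by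
      rw [map_sub, neg_sub]; rfl
    rw [this, hu, map_zero, neg_zero]
  obtain ⟨l, hl, r, hr, hlr⟩ := Submodule.mem_sup.1 (key hu')
  obtain ⟨l, hl', rfl⟩ := hadj' L hl
  obtain ⟨r, hr', rfl⟩ := hright hr
  refine Submodule.mem_sup.2 ⟨l, hl', r, hr', o.injective ?_⟩
  rw [map_add]
  exact hlr

end Weights

/-! ### The tensor power of the enveloping algebra -/

section TensorPower

variable {k : ℕ} {g : Type*} [LieRing g] [LieAlgebra ℂ g]

theorem slot_eq_single (i : Fin k) (y : g) : slot i y =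
    PiTensorProduct.singleAlgHom (R := ℂ) (A := fun _ : Fin k => UniversalEnvelopingAlgebra ℂ g) i
      (UniversalEnvelopingAlgebra.ι ℂ y) := rfl

theorem slot_eq_tprod (i : Fin k) (y : g) : slot i y =
    PiTensorProduct.tprod ℂ (Pi.mulSingle (M := fun _ => UniversalEnvelopingAlgebra ℂ g) i
      (UniversalEnvelopingAlgebra.ι ℂ y)) := rfl

theorem slot_lie (i : Fin k) (x y : g) :
    slot i ⁅x, y⁆ = slot i x * slot i y - slot i y * slot i x := by
  simp only [slot_eq_single, LieHom.map_lie, LieRing.of_associative_ring_bracket, map_sub, map_mul]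

theorem slot_comm (i j : Fin k) (hij : i ≠ j) (x y : g) :
    slot i x * slot j y = slot j y * slot i x := by
  rw [slot_eq_tprod, slot_eq_tprod, PiTensorProduct.tprod_mul_tprod,
    PiTensorProduct.tprod_mul_tprod]
  congr 1
  exact Pi.mulSingle_commute (f := fun _ => UniversalEnvelopingAlgebra ℂ g) hij _ _

/-- `U(g)^{⊗ k}` is generated by the elements `y_i`. -/
theorem adjoin_genSet_slot : Algebra.adjoin ℂ (genSet (slot (k := k) (g := g)) ⊤) = ⊤ := by
  set S := Algebra.adjoin ℂ (genSet (slot (k := k) (g := g)) ⊤)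
  have h1 : ∀ (i : Fin k) (u : UniversalEnvelopingAlgebra ℂ g),
      PiTensorProduct.singleAlgHom (R := ℂ)
        (A := fun _ : Fin k => UniversalEnvelopingAlgebra ℂ g) i u ∈ S := by
    intro i u
    induction u using env_induction with
    | one => rw [map_one]; exact one_mem _
    | add u v hu hv => rw [map_add]; exact add_mem hu hv
    | smul r u hu => rw [map_smul]; exact S.smul_mem hu r
    | ι_mul y u hu =>
      rw [map_mul]
      exact mul_mem (Algebra.subset_adjoin ⟨i, y, trivial, rfl⟩) hu
  -- A pure tensor is built up one factor at a time, with `1` in the slots not yet filled.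
  have h2 : ∀ (f : Fin k → UniversalEnvelopingAlgebra ℂ g) (t : Finset (Fin k)),
      PiTensorProduct.tprod ℂ (fun i => if i ∈ t then f i else 1) ∈ S := by
    intro f t
    induction t using Finset.induction_on with
    | empty => exact one_mem S
    | insert i t hi ht =>
      have := mul_mem (h1 i (f i)) ht
      rw [PiTensorProduct.singleAlgHom_apply, PiTensorProduct.tprod_mul_tprod] at this
      convert this using 2
      ext j
      rcases eq_or_ne j i with rfl | hj
      · simp [hi]
      · simp [hj]
  rw [eq_top_iff]
  intro u _
  induction u using PiTensorProduct.induction_on with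
  | smul_tprod r f => exact S.smul_mem (by simpa using h2 f Finset.univ) r
  | add u v hu hv => exact add_mem (hu trivial) (hv trivial)

theorem inclTensor_tprod (l : LieSubalgebra ℂ g) (f : Fin k → UniversalEnvelopingAlgebra ℂ l) :
    inclTensor k l (PiTensorProduct.tprod ℂ f) =
      PiTensorProduct.tprod ℂ (fun i => envIncl l (f i)) :=
  PiTensorProduct.lift.tprod _

theorem inclTensor_slot (l : LieSubalgebra ℂ g) (i : Fin k) (x : l) :
    inclTensor k l (slot i x) = slot i (x : g) := by
  rw [slot_eq_tprod, inclTensor_tprod, slot_eq_tprod]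
  congr 1
  ext j
  rcases eq_or_ne j i with rfl | hj
  · simp only [Pi.mulSingle_eq_same]; exact envIncl_ι l x
  · simp [Pi.mulSingle_eq_of_ne hj]

theorem inclTensor_diagonal (l : LieSubalgebra ℂ g) (x : l) :
    inclTensor k l (diagonal k x) = diagonal k (x : g) := by
  simp only [diagonal, LinearMap.sum_apply, map_sum, inclTensor_slot]

theorem range_inclTensor (l : LieSubalgebra ℂ g) :
    (inclTensor k l).range = Algebra.adjoin ℂ (genSet (slot (k := k)) l.toSubmodule) := by
  rw [← Algebra.map_top, ← adjoin_genSet_slot, AlgHom.map_adjoin]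
  congr 1
  ext w
  constructor
  · rintro ⟨_, ⟨i, x, -, rfl⟩, rfl⟩
    exact ⟨i, x, x.2, inclTensor_slot l i x⟩
  · rintro ⟨i, x, hx, rfl⟩
    exact ⟨slot i (⟨x, hx⟩ : l), ⟨i, _, trivial, rfl⟩, inclTensor_slot l i ⟨x, hx⟩⟩

theorem leftSum_eq (n : Submodule ℂ g) : leftSum k n = leftIdeal slot n := by
  refine le_antisymm (iSup_le fun i => Submodule.span_mono ?_) (Submodule.span_le.2 ?_)
  · rintro _ ⟨u, y, hy, rfl⟩; exact ⟨i, y, hy, u, rfl⟩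
  · rintro _ ⟨i, y, hy, u, rfl⟩
    exact Submodule.mem_iSup_of_mem i (Submodule.subset_span ⟨u, y, hy, rfl⟩)

theorem rightSum_eq (n : Submodule ℂ g) : rightSum k n = rightIdeal slot n := by
  refine le_antisymm (iSup_le fun i => Submodule.span_mono ?_) (Submodule.span_le.2 ?_)
  · rintro _ ⟨u, y, hy, rfl⟩; exact ⟨i, y, hy, u, rfl⟩
  · rintro _ ⟨i, y, hy, u, rfl⟩
    exact Submodule.mem_iSup_of_mem i (Submodule.subset_span ⟨u, y, hy, rfl⟩)

variable {l : LieSubalgebra ℂ g}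
  {r : UniversalEnvelopingAlgebra ℂ g →ₗ[ℂ] UniversalEnvelopingAlgebra ℂ l}

/-- The tensor power of a linear map `U(g) → U(l)`. -/
def tensorMap (k : ℕ) (r : UniversalEnvelopingAlgebra ℂ g →ₗ[ℂ] UniversalEnvelopingAlgebra ℂ l) :
    UTensor k g →ₗ[ℂ] UTensor k l := PiTensorProduct.map fun _ => r

theorem tensorMap_inclTensor (hr : ∀ m, r (envIncl l m) = m) (t : UTensor k l) :
    tensorMap k r (inclTensor k l t) = t := by
  induction t using PiTensorProduct.induction_on with
  | smul_tprod c f =>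
    rw [map_smul, map_smul, inclTensor_tprod, tensorMap, PiTensorProduct.map_tprod]
    simp only [hr]
  | add u v hu hv => rw [map_add, map_add, hu, hv]

theorem tensorMap_leftSum {n : Submodule ℂ g}
    (hr : ∀ x ∈ n, ∀ u, r (u * UniversalEnvelopingAlgebra.ι ℂ x) = 0) {u : UTensor k g}
    (hu : u ∈ leftSum k n) : tensorMap k r u = 0 := by
  rw [leftSum_eq] at hu
  suffices h : leftIdeal slot n ≤ LinearMap.ker (tensorMap k r) from h hu
  refine Submodule.span_le.2 ?_
  rintro _ ⟨i, y, hy, u, rfl⟩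
  rw [SetLike.mem_coe, LinearMap.mem_ker]
  induction u using PiTensorProduct.induction_on with
  | smul_tprod c f =>
    -- Multiplication by `slot i y` alters only factor `i` of a pure tensor, and `r` sends that
    -- factor to zero.
    rw [smul_mul_assoc, map_smul, slot_eq_tprod, PiTensorProduct.tprod_mul_tprod, tensorMap,
      PiTensorProduct.map_tprod, MultilinearMap.map_coord_zero _ i, smul_zero]
    rw [Pi.mul_apply, Pi.mulSingle_eq_same, hr y hy]
  | add u v hu hv => rw [add_mul, map_add, hu, hv, add_zero]

theorem tensorMap_rightSum {n : Submodule ℂ g}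
    (hr : ∀ x ∈ n, ∀ u, r (UniversalEnvelopingAlgebra.ι ℂ x * u) = 0) {u : UTensor k g}
    (hu : u ∈ rightSum k n) : tensorMap k r u = 0 := by
  rw [rightSum_eq] at hu
  suffices h : rightIdeal slot n ≤ LinearMap.ker (tensorMap k r) from h hu
  refine Submodule.span_le.2 ?_
  rintro _ ⟨i, y, hy, u, rfl⟩
  rw [SetLike.mem_coe, LinearMap.mem_ker]
  induction u using PiTensorProduct.induction_on with
  | smul_tprod c f =>
    rw [mul_smul_comm, map_smul, slot_eq_tprod, PiTensorProduct.tprod_mul_tprod, tensorMap,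
      PiTensorProduct.map_tprod, MultilinearMap.map_coord_zero _ i, smul_zero]
    rw [Pi.mul_apply, Pi.mulSingle_eq_same, hr y hy]
  | add u v hu hv => rw [mul_add, map_add, hu, hv, add_zero]

end TensorPower

/-! ### Triangular decompositions from a grading element -/

section Grading

variable {K g : Type*} [Field K] [LieRing g] [LieAlgebra K g]

/-- The sum of the eigenspaces of `ad z` for positive integral eigenvalues. -/
def posPart (K : Type*) {g : Type*} [Field K] [LieRing g] [LieAlgebra K g] (z : g) :
    Submodule K g := ⨆ n : ℕ, (LieAlgebra.ad K g z).eigenspace ((n : K) + 1)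

theorem lie_mem_eigenspace_ad {z x y : g} {μ ν : K} (hx : x ∈ (LieAlgebra.ad K g z).eigenspace μ)
    (hy : y ∈ (LieAlgebra.ad K g z).eigenspace ν) :
    ⁅x, y⁆ ∈ (LieAlgebra.ad K g z).eigenspace (μ + ν) := by
  rw [Module.End.mem_eigenspace_iff, LieAlgebra.ad_apply] at *
  rw [leibniz_lie, hx, hy, smul_lie, lie_smul, add_smul]

theorem eigenspace_le_posPart (z : g) (n : ℕ) :
    (LieAlgebra.ad K g z).eigenspace ((n : K) + 1) ≤ posPart K z :=
  le_iSup (fun n : ℕ => (LieAlgebra.ad K g z).eigenspace ((n : K) + 1)) n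

theorem lie_posPart {z x y : g} (hx : x ∈ posPart K z) (hy : y ∈ posPart K z) :
    ⁅x, y⁆ ∈ posPart K z := by
  induction hx using Submodule.iSup_induction' with
  | mem m x hx =>
    induction hy using Submodule.iSup_induction' with
    | mem n y hy =>
      refine eigenspace_le_posPart z (m + n + 1) ?_
      convert lie_mem_eigenspace_ad hx hy using 2
      push_cast; ring
    | zero => simp
    | add u v _ _ hu hv => rw [lie_add]; exact add_mem hu hv
  | zero => simp
  | add u v _ _ hu hv => rw [add_lie]; exact add_mem hu hv

theorem zero_lie_posPart {z x y : g} (hx : ⁅z, x⁆ = 0) (hy : y ∈ posPart K z) :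
    ⁅x, y⁆ ∈ posPart K z := by
  induction hy using Submodule.iSup_induction' with
  | mem n y hy =>
    refine eigenspace_le_posPart z n ?_
    have := lie_mem_eigenspace_ad (μ := (0 : K)) (x := x)
      (by rw [Module.End.mem_eigenspace_iff, LieAlgebra.ad_apply, hx, zero_smul]) hy
    rwa [zero_add] at this
  | zero => simp
  | add u v _ _ hu hv => rw [lie_add]; exact add_mem hu hv

theorem eigenspace_ad_neg (z : g) (μ : K) :
    (LieAlgebra.ad K g (-z)).eigenspace μ = (LieAlgebra.ad K g z).eigenspace (-μ) := by
  ext x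
  simp only [Module.End.mem_eigenspace_iff, LieAlgebra.ad_apply, neg_lie, neg_smul,
    neg_eq_iff_eq_neg]

variable [CharZero K]

theorem disjoint_posPart (z : g) :
    Disjoint ((LieAlgebra.ad K g z).eigenspace 0) (posPart K z ⊔ posPart K (-z)) := by
  refine (Module.End.eigenspaces_iSupIndep (LieAlgebra.ad K g z) 0).mono_right (sup_le ?_ ?_)
  · exact iSup_le fun n => le_iSup₂_of_le
      (f := fun (μ : K) (_ : μ ≠ 0) => (LieAlgebra.ad K g z).eigenspace μ) ((n : K) + 1)
      (Nat.cast_add_one_ne_zero n) le_rfl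
  · refine iSup_le fun n => ?_
    rw [eigenspace_ad_neg]
    exact le_iSup₂_of_le
      (f := fun (μ : K) (_ : μ ≠ 0) => (LieAlgebra.ad K g z).eigenspace μ) (-((n : K) + 1))
      (neg_ne_zero.2 (Nat.cast_add_one_ne_zero n)) le_rfl

theorem disjoint_posPart_neg (z : g) : Disjoint (posPart K z) (posPart K (-z)) := by
  -- Eigenspaces for disjoint sets of eigenvalues are independent; `m + 1 = -(n + 1)` is impossible
  -- in characteristic zero.
  have hind := Module.End.eigenspaces_iSupIndep (LieAlgebra.ad K g z)
  have := hind.disjoint_biSup_biSup (s := Set.range fun n : ℕ => (n : K) + 1)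
    (t := Set.range fun n : ℕ => -((n : K) + 1)) (by
      rw [Set.disjoint_left]
      rintro _ ⟨m, rfl⟩ ⟨n, hn⟩
      have h : ((n + 1 + (m + 1) : ℕ) : K) = 0 := by
        push_cast
        simp only at hn
        rw [← hn]; ring
      have := Nat.cast_eq_zero.1 h
      omega)
  refine this.mono ?_ ?_
  · exact iSup_le fun n => le_iSup₂_of_le (f := fun (μ : K)
      (_ : μ ∈ Set.range fun n : ℕ => (n : K) + 1) => (LieAlgebra.ad K g z).eigenspace μ)
      ((n : K) + 1) ⟨n, rfl⟩ le_rfl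
  · refine iSup_le fun n => ?_
    rw [eigenspace_ad_neg]
    exact le_iSup₂_of_le (f := fun (μ : K)
      (_ : μ ∈ Set.range fun n : ℕ => -((n : K) + 1)) => (LieAlgebra.ad K g z).eigenspace μ)
      (-((n : K) + 1)) ⟨n, rfl⟩ le_rfl

/-- The projection `U(g) → U(l)` for the triangular decomposition `g = N + l + Q` in which
`N`, `l`, `Q` have negative, zero and positive weights under `z`. -/
theorem exists_env_projection_of_grading (l : LieSubalgebra K g) {N Q : Submodule K g} {z : g}
    (hl : ∀ x ∈ l, ⁅z, x⁆ = 0) (hN : N ≤ posPart K (-z)) (hQ : Q ≤ posPart K z)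
    (htop : l.toSubmodule ⊔ Q ⊔ N = ⊤) :
    ∃ r : UniversalEnvelopingAlgebra K g →ₗ[K] UniversalEnvelopingAlgebra K l,
      (∀ m, r (envIncl l m) = m) ∧
      (∀ y ∈ N, ∀ u, r (UniversalEnvelopingAlgebra.ι K y * u) = 0) ∧
      (∀ x ∈ Q, ∀ u, r (u * UniversalEnvelopingAlgebra.ι K x) = 0) := by
  have hl0 : l.toSubmodule ≤ (LieAlgebra.ad K g z).eigenspace 0 := fun x hx => by
    rw [Module.End.mem_eigenspace_iff, LieAlgebra.ad_apply, hl x hx, zero_smul]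
  have dec : ∀ x, ∃ a ∈ l, ∃ b ∈ Q, ∃ c ∈ N, x = a + b + c := by
    intro x
    obtain ⟨y, hy, c, hc, rfl⟩ := Submodule.mem_sup.1
      (show x ∈ l.toSubmodule ⊔ Q ⊔ N by rw [htop]; trivial)
    obtain ⟨a, ha, b, hb, rfl⟩ := Submodule.mem_sup.1 hy
    exact ⟨a, ha, b, hb, c, hc, rfl⟩
  have uniq : ∀ a ∈ l, ∀ b ∈ posPart K z, ∀ c ∈ posPart K (-z), a + b + c = 0 →
      a = 0 ∧ b = 0 ∧ c = 0 := by
    intro a ha b hb c hc h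
    have ha0 : a = 0 := Submodule.disjoint_def.1 (disjoint_posPart z) a (hl0 ha) (by
      have : a = -(b + c) := by rw [eq_neg_iff_add_eq_zero, ← add_assoc, h]
      rw [this]
      exact neg_mem (add_mem (Submodule.mem_sup_left hb) (Submodule.mem_sup_right hc)))
    rw [ha0, zero_add] at h
    have hb0 : b = 0 := Submodule.disjoint_def.1 (disjoint_posPart_neg z) b hb (by
      rw [eq_neg_of_add_eq_zero_left h]; exact neg_mem hc)
    exact ⟨ha0, hb0, by rwa [hb0, zero_add] at h⟩
  -- Because the three pieces span, `Q` and `N` must be the whole positive and negative parts. Their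
  -- closure under brackets, and under brackets with `l`, is then just additivity of weights.
  have posQ : ∀ x ∈ posPart K z, x ∈ Q := by
    intro x hx
    obtain ⟨a, ha, b, hb, c, hc, rfl⟩ := dec x
    obtain ⟨ha0, -, hc0⟩ := uniq a ha (b - (a + b + c)) (sub_mem (hQ hb) hx) c (hN hc) (by abel)
    rwa [ha0, hc0, zero_add, add_zero]
  have negN : ∀ x ∈ posPart K (-z), x ∈ N := by
    intro x hx
    obtain ⟨a, ha, b, hb, c, hc, rfl⟩ := dec x
    obtain ⟨ha0, hb0, -⟩ := uniq a ha b (hQ hb) (c - (a + b + c)) (sub_mem (hN hc) hx) (by abel)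
    rwa [ha0, hb0, add_zero, zero_add]
  let a : LieSubalgebra K g :=
    { N with lie_mem' := fun {x y} hx hy => negN _ (lie_posPart (hN hx) (hN hy)) }
  have hcN : IsCompl N (l.toSubmodule ⊔ Q) := by
    refine ⟨Submodule.disjoint_def.2 fun x hx hx' => ?_, codisjoint_iff.2 (by rw [sup_comm, htop])⟩
    obtain ⟨y, hy, w, hw, rfl⟩ := Submodule.mem_sup.1 hx'
    obtain ⟨h1, h2, -⟩ := uniq y hy w (hQ hw) (-(y + w)) (neg_mem (hN hx)) (by abel)
    rw [h1, h2, add_zero]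
  have hcl : IsCompl l.toSubmodule (Q ⊔ N) := by
    refine ⟨Submodule.disjoint_def.2 fun x hx hx' => ?_,
      codisjoint_iff.2 (by rw [← sup_assoc, htop])⟩
    obtain ⟨y, hy, w, hw, rfl⟩ := Submodule.mem_sup.1 hx'
    obtain ⟨-, h1, h2⟩ := uniq (-(y + w)) (neg_mem hx) y (hQ hy) w (hN hw) (by abel)
    rw [h1, h2, add_zero]
  let pa : g →ₗ[K] a := Submodule.projectionOnto N (l.toSubmodule ⊔ Q) hcN
  let pl : g →ₗ[K] l := Submodule.projectionOnto l.toSubmodule (Q ⊔ N) hcl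
  have hpa0 : ∀ x, pa x = 0 ↔ x ∈ l.toSubmodule ⊔ Q :=
    fun x => Submodule.projectionOnto_apply_eq_zero_iff hcN
  have hpl0 : ∀ x, pl x = 0 ↔ x ∈ Q ⊔ N :=
    fun x => Submodule.projectionOnto_apply_eq_zero_iff hcl
  have hpll : ∀ x : l, pl x = x := fun x => Submodule.projectionOnto_apply_left hcl x
  obtain ⟨r, h1, h2, h3⟩ := exists_env_projection l a.incl pa pl
    (fun s => Submodule.projectionOnto_apply_left hcN s)
    (fun s => (hpl0 _).2 (Submodule.mem_sup_right s.2))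
    -- The kernel of `pa` is `l + Q`, in which `Q` is an ideal, so `pl` respects brackets there.
    (fun x => (hpa0 _).2 (Submodule.mem_sup_left x.2)) hpll (by
      intro x x' hx hx'
      obtain ⟨y, hy, w, hw, rfl⟩ := Submodule.mem_sup.1 ((hpa0 x).1 hx)
      obtain ⟨y', hy', w', hw', rfl⟩ := Submodule.mem_sup.1 ((hpa0 x').1 hx')
      have e1 : ⁅w, y'⁆ ∈ Q := by
        rw [← lie_skew]
        exact neg_mem (posQ _ (zero_lie_posPart (hl _ hy') (hQ hw)))
      have e : ⁅y, w'⁆ + ⁅w, y'⁆ + ⁅w, w'⁆ ∈ Q :=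
        add_mem (add_mem (posQ _ (zero_lie_posPart (hl _ hy) (hQ hw'))) e1)
          (posQ _ (lie_posPart (hQ hw) (hQ hw')))
      have e2 : ⁅y + w, y' + w'⁆ = ⁅y, y'⁆ + (⁅y, w'⁆ + ⁅w, y'⁆ + ⁅w, w'⁆) := by
        simp only [add_lie, lie_add]; abel
      have hyw : ∀ y (hy : y ∈ l), ∀ w ∈ Q, pl (y + w) = ⟨y, hy⟩ := by
        intro y hy w hw
        rw [map_add, (hpl0 w).2 (Submodule.mem_sup_left hw), add_zero]
        exact hpll ⟨y, hy⟩
      rw [e2]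
      refine ⟨(hpa0 _).2 (add_mem (Submodule.mem_sup_left (l.lie_mem hy hy'))
        (Submodule.mem_sup_right e)), ?_⟩
      rw [hyw _ (l.lie_mem hy hy') _ e, hyw y hy w hw, hyw y' hy' w' hw']
      rfl)
  refine ⟨r, h1, fun y hy u => h2 ⟨y, hy⟩ u, fun x hx u => h3 x u
    ((hpa0 _).2 (Submodule.mem_sup_right hx)) ((hpl0 _).2 (Submodule.mem_sup_left hx))⟩

end Grading

/-! ### Root spaces, the Levi subalgebra and the grading element -/

section Roots

open LieModule

variable {g : Type*} [LieRing g] [LieAlgebra ℂ g] [FiniteDimensional ℂ g]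
  [LieAlgebra.IsSemisimple ℂ g] {H : LieSubalgebra ℂ g} [H.IsCartanSubalgebra]

/-- If `α(γ^∨)` is positive, then `g_α = [g_γ, g_{α - γ}]`. -/
theorem exists_lie_eq_of_coroot_pos (α γ : Weight ℂ H g) (hα : α.IsNonZero) (hγ : γ.IsNonZero)
    {n : ℕ} (hn : 0 < n) (hpos : α (coroot γ) = n) :
    ∃ e ∈ rootSpace H (γ : H → ℂ), ∀ x ∈ rootSpace H (α : H → ℂ),
      ∃ y ∈ rootSpace H (α - γ : H → ℂ), ⁅e, y⁆ = x := by
  obtain ⟨h, e, f, ht, he, hf⟩ := exists_isSl2Triple_of_weight_isNonZero hγ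
  refine ⟨e, he, ?_⟩
  obtain ⟨x', hx', hx'0⟩ := (-α).exists_ne_zero
  have hex' : ⁅e, x'⁆ ≠ 0 := by
    intro h0
    -- If `e` killed a nonzero vector of `g_{-α}`, that vector would be primitive of negative weight
    -- `-n`, impossible in a finite-dimensional `sl₂`-module.
    have hp : ht.HasPrimitiveVectorWith x' (-(n : ℂ)) :=
      { ne_zero := hx'0
        lie_h := by
          rw [ht.h_eq_coroot hγ he hf, ← H.coe_bracket_of_module]
          refine (lie_eq_smul_of_mem_rootSpace hx' (coroot γ)).trans ?_
          rw [Weight.coe_neg, Pi.neg_apply, hpos]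
        lie_e := h0 }
    obtain ⟨m, hm⟩ := hp.exists_nat
    have : ((m + n : ℕ) : ℂ) = 0 := by push_cast; rw [← hm]; ring
    have := Nat.cast_eq_zero.1 this
    omega
  have hmem : ⁅e, x'⁆ ∈ rootSpace H (γ + (-α) : H → ℂ) :=
    lie_mem_genWeightSpace_of_mem_genWeightSpace he (by rwa [Weight.coe_neg] at hx')
  -- Nondegeneracy of the Killing form gives a partner `y`; invariance turns the pairing into one
  -- with `[e, y]`, which is hence nonzero and spans the line `g_α`.
  obtain ⟨y, hy, hy0⟩ : ∃ y ∈ rootSpace H (-(γ + (-α) : H → ℂ)),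
      killingForm ℂ g ⁅e, x'⁆ y ≠ 0 := by
    contrapose! hex'
    simpa using mem_ker_killingForm_of_mem_rootSpace_of_forall_rootSpace_neg ℂ g H hmem hex'
  have hy' : y ∈ rootSpace H (α - γ : H → ℂ) := by
    have : (α - γ : H → ℂ) = -(γ + (-α) : H → ℂ) := by abel
    rwa [this]
  have hey : ⁅e, y⁆ ≠ 0 := by
    intro h0
    apply hy0
    rw [← lie_skew, map_neg, LinearMap.neg_apply, LieModule.traceForm_apply_lie_apply, h0, map_zero,
      neg_zero]
  have hey' : ⁅e, y⁆ ∈ rootSpace H (α : H → ℂ) := by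
    have := lie_mem_genWeightSpace_of_mem_genWeightSpace he hy'
    rwa [add_sub_cancel] at this
  intro x hx
  obtain ⟨c, hc⟩ := (finrank_eq_one_iff_of_nonzero' (⟨⁅e, y⁆, hey'⟩ : rootSpace H (α : H → ℂ))
    (by simpa using hey)).mp (finrank_rootSpace_eq_one α hα) ⟨x, hx⟩
  refine ⟨c • y, Submodule.smul_mem _ c hy', ?_⟩
  rw [lie_smul]
  exact congrArg Subtype.val hc

variable (b : (rootSystem H).Base) (D : Set H.root)

open Classical in
/-- The element of the Cartan subalgebra on which the simple roots in `D` vanish and the other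
simple roots take the value `1`. -/
theorem exists_grading_element :
    ∃ z : H, ∀ α ∈ b.support, (α.1 : H → ℂ) z = if α ∈ D then 0 else 1 := by
  -- The simple roots form a basis of the dual of `H`, so their values may be prescribed; biduality
  -- turns the resulting functional into a point of `H`.
  let φ : Module.Dual ℂ (Module.Dual ℂ H) :=
    b.toWeightBasis.constr ℂ (fun i => if (i : H.root) ∈ D then (0 : ℂ) else 1)
  refine ⟨(Module.evalEquiv ℂ H).symm φ, fun α hα => ?_⟩
  have h1 : (rootSystem H).root α ((Module.evalEquiv ℂ H).symm φ) = φ ((rootSystem H).root α) :=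
    Module.apply_evalEquiv_symm_apply ℂ H _ φ
  have h2 := b.toWeightBasis.constr_basis ℂ
    (fun i => if (i : H.root) ∈ D then (0 : ℂ) else 1) ⟨α, hα⟩
  rw [RootPairing.Base.toWeightBasis_apply] at h2
  exact h1.trans h2

variable {b D} {z : H}

-- A positive root is a nonnegative integral combination of simple roots; its value at `z` is the
-- sum of the coefficients at simple roots outside `D`.
open Classical in
theorem exists_nat_of_isPos
    (hz : ∀ α ∈ b.support, (α.1 : H → ℂ) z = if α ∈ D then 0 else 1) {α : H.root}
    (hα : b.IsPos α) : ∃ n : ℕ, (α.1 : H → ℂ) z = n := by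
  obtain ⟨f, -, hf, hsum⟩ := b.exists_root_eq_sum_int α
  have hf0 : 0 < f := by
    refine hf.resolve_right fun hneg => ?_
    rw [RootPairing.Base.isPos_iff, RootPairing.Base.height_eq_sum hsum] at hα
    exact absurd hα (not_lt.2 (Finset.sum_nonpos fun i _ => hneg.le i))
  have h1 : (α.1 : H → ℂ) z = ∑ j ∈ b.support, (f j : ℂ) * (if j ∈ D then 0 else 1) := by
    have := LinearMap.congr_fun hsum z
    rw [LinearMap.sum_apply] at this
    refine this.trans (Finset.sum_congr rfl fun j hj => ?_)
    rw [LinearMap.smul_apply, zsmul_eq_mul, ← hz j hj]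
    rfl
  refine ⟨∑ j ∈ b.support, (f j).toNat * (if j ∈ D then 0 else 1), ?_⟩
  rw [h1]
  push_cast
  refine Finset.sum_congr rfl fun j _ => ?_
  have : (((f j).toNat : ℤ) : ℂ) = (f j : ℂ) := by rw [Int.toNat_of_nonneg (hf0.le j)]
  rw [← this, Int.cast_natCast]

theorem root_neg_index (α : H.root) : ∃ α' : H.root, (α'.1 : H → ℂ) = -(α.1 : H → ℂ) ∧
    (b.IsPos α' ↔ ¬ b.IsPos α) := by
  refine ⟨(rootSystem H).reflectionPerm α α, ?_, RootPairing.Base.IsPos.neg_iff_not b α⟩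
  have h : (rootSystem H).root ((rootSystem H).reflectionPerm α α) = -(rootSystem H).root α := by
    rw [RootPairing.root_reflectionPerm, RootPairing.reflection_apply_self]
  ext x
  exact LinearMap.congr_fun h x

-- Induction on height: subtracting a simple root `j` with positive pairing leaves a positive root
-- `β`. The values of `β` and `j` at `z` are nonnegative with sum zero, so both vanish; thus `j ∈
-- D`, and `g_α = [g_j, g_β]` lies in `g_D`. This identifies the roots missing from `R_D` as those
-- with nonzero value at `z`.
open Classical in
theorem rootSpace_le_diagSubalgebra
    (hz : ∀ α ∈ b.support, (α.1 : H → ℂ) z = if α ∈ D then 0 else 1) {α : H.root}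
    (hα : b.IsPos α) (hα0 : (α.1 : H → ℂ) z = 0) :
    (∀ x ∈ rootSpace H (α.1 : H → ℂ), x ∈ diagSubalgebra H D) ∧
      (∀ x ∈ rootSpace H (-(α.1 : H → ℂ)), x ∈ diagSubalgebra H D) := by
  have simple : ∀ j ∈ b.support, (j.1 : H → ℂ) z = 0 →
      (∀ x ∈ rootSpace H (j.1 : H → ℂ), x ∈ diagSubalgebra H D) ∧
      (∀ x ∈ rootSpace H (-(j.1 : H → ℂ)), x ∈ diagSubalgebra H D) := by
    intro j hj hj0
    have hjD : j ∈ D := by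
      by_contra h
      rw [hz j hj, if_neg h] at hj0
      exact one_ne_zero hj0
    exact ⟨fun x hx => LieSubalgebra.subset_lieSpan ⟨j, hjD, Or.inl hx⟩,
      fun x hx => LieSubalgebra.subset_lieSpan ⟨j, hjD, Or.inr hx⟩⟩
  generalize hN : (b.height α).toNat = N
  induction N using Nat.strong_induction_on generalizing α with
  | _ N ih =>
    obtain ⟨j, hj, hj'⟩ := hα.exists_mem_support_pos_pairingIn
    rw [(rootSystem H).zero_lt_pairingIn_iff'] at hj'
    rcases eq_or_ne α j with rfl | hij
    · exact simple α hj hα0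
    obtain ⟨β, hβ⟩ := (rootSystem H).root_sub_root_mem_of_pairingIn_pos hj' hij
    have hβpos : b.IsPos β := hα.sub hj hβ
    have hβfun : (β.1 : H → ℂ) = (α.1 : H → ℂ) - (j.1 : H → ℂ) := by
      ext x; exact LinearMap.congr_fun hβ x
    have hβht : b.height β = b.height α - 1 := by
      rw [b.height_sub hβ, RootPairing.Base.height_one_of_mem_support hj]
    have hzero : (β.1 : H → ℂ) z = 0 ∧ (j.1 : H → ℂ) z = 0 := by
      obtain ⟨n, hn⟩ := exists_nat_of_isPos hz hβpos
      obtain ⟨m, hm⟩ := exists_nat_of_isPos hz (RootPairing.Base.isPos_of_mem_support hj)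
      have hs : ((n + m : ℕ) : ℂ) = 0 := by
        push_cast
        rw [← hn, ← hm, hβfun, Pi.sub_apply, hα0]; ring
      have := Nat.cast_eq_zero.1 hs
      rw [hn, hm]
      constructor <;> norm_cast <;> omega
    obtain ⟨hβ1, hβ2⟩ := ih (b.height β).toNat (by
      have := (RootPairing.Base.isPos_iff b).1 hβpos
      omega) hβpos hzero.1 rfl
    obtain ⟨hj1, hj2⟩ := simple j hj hzero.2
    obtain ⟨n, hn⟩ : ∃ n : ℕ, (rootSystem H).pairingIn ℤ α j = n :=
      ⟨_, (Int.toNat_of_nonneg hj'.le).symm⟩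
    have hpair : (α.1 : H → ℂ) (coroot j.1) = n := by
      rw [← rootSystem_pairing_apply, ← (rootSystem H).algebraMap_pairingIn ℤ, hn]
      simp
    have hn0 : 0 < n := by omega
    have hαn := LieSubalgebra.isNonZero_coe_root α
    have hjn := LieSubalgebra.isNonZero_coe_root j
    constructor
    · obtain ⟨e, he, hex⟩ := exists_lie_eq_of_coroot_pos α.1 j.1 hαn hjn hn0 hpair
      intro x hx
      obtain ⟨y, hy, rfl⟩ := hex x hx
      rw [← hβfun] at hy
      exact (diagSubalgebra H D).lie_mem (hj1 e he) (hβ1 y hy)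
    -- Negating both roots leaves the pairing unchanged, so the same argument handles the negative
    -- root space.
    · obtain ⟨e, he, hex⟩ := exists_lie_eq_of_coroot_pos (-α.1) (-j.1)
        (fun h => by simp at h) (fun h => by simp at h) hn0
        (by rw [coroot_neg, Weight.coe_neg, Pi.neg_apply, ← hpair]; simp)
      intro x hx
      rw [Weight.coe_neg] at hex he
      obtain ⟨y, hy, rfl⟩ := hex x hx
      rw [Weight.coe_neg] at hy
      have : -(α.1 : H → ℂ) - -(j.1 : H → ℂ) = -(β.1 : H → ℂ) := by rw [hβfun]; abel
      rw [this] at hy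
      exact (diagSubalgebra H D).lie_mem (hj2 e he) (hβ2 y hy)

theorem lie_eq_smul_of_rootSpace {χ : H → ℂ} {x : g} (hx : x ∈ rootSpace H χ) :
    ⁅(z : g), x⁆ = χ z • x :=
  lie_eq_smul_of_mem_rootSpace hx z

open Classical in
theorem lie_diagSubalgebra_eq_zero (hD : D ⊆ (b.support : Set H.root))
    (hz : ∀ α ∈ b.support, (α.1 : H → ℂ) z = if α ∈ D then 0 else 1) {x : g}
    (hx : x ∈ diagSubalgebra H D) : ⁅(z : g), x⁆ = 0 := by
  induction hx using LieSubalgebra.lieSpan_induction with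
  | mem x hx =>
    obtain ⟨α, hα, hx⟩ := hx
    have h0 : (α.1 : H → ℂ) z = 0 := by rw [hz α (hD hα), if_pos hα]
    rcases hx with hx | hx
    · rw [lie_eq_smul_of_rootSpace hx, h0, zero_smul]
    · rw [lie_eq_smul_of_rootSpace hx, Pi.neg_apply, h0, neg_zero, zero_smul]
  | zero => simp
  | add x y _ _ hx hy => rw [lie_add, hx, hy, add_zero]
  | smul a x _ hx => rw [lie_smul, hx, smul_zero]
  | lie x y _ _ hx hy => rw [leibniz_lie, hx, hy, zero_lie, lie_zero, add_zero]

theorem mem_levi {x : g} : x ∈ levi H D ↔ x ∈ (diagSubalgebra H D).toSubmodule ⊔ H.toSubmodule := Iff.rfl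

open Classical in
theorem lie_levi_eq_zero (hD : D ⊆ (b.support : Set H.root))
    (hz : ∀ α ∈ b.support, (α.1 : H → ℂ) z = if α ∈ D then 0 else 1) {x : g}
    (hx : x ∈ levi H D) : ⁅(z : g), x⁆ = 0 := by
  obtain ⟨y, hy, h, hh, rfl⟩ := Submodule.mem_sup.1 (mem_levi.1 hx)
  rw [LieSubalgebra.mem_toSubmodule] at hy hh
  have h2 : ⁅(z : g), h⁆ = 0 := by
    have : ⁅z, (⟨h, hh⟩ : H)⁆ = 0 := trivial_lie_zero H H _ _
    exact congrArg Subtype.val this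
  rw [lie_add, lie_diagSubalgebra_eq_zero hD hz hy, h2, add_zero]

open Classical in
theorem mem_leviCenter (hD : D ⊆ (b.support : Set H.root))
    (hz : ∀ α ∈ b.support, (α.1 : H → ℂ) z = if α ∈ D then 0 else 1) :
    (z : g) ∈ leviCenter H D := by
  refine ⟨⟨z, mem_levi.2 (Submodule.mem_sup_right z.2)⟩, ?_, rfl⟩
  intro x
  refine Subtype.ext ?_
  change ⁅(x : g), (z : g)⁆ = 0
  rw [← lie_skew, lie_levi_eq_zero hD hz x.2, neg_zero]

theorem lie_eq_zero_of_mem_leviCenter {c x : g} (hc : c ∈ leviCenter H D) (hx : x ∈ levi H D) :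
    ⁅c, x⁆ = 0 := by
  obtain ⟨c, hc, rfl⟩ := hc
  have h : ⁅(⟨x, hx⟩ : levi H D), c⁆ = 0 := hc ⟨x, hx⟩
  have h' : ⁅x, (c : g)⁆ = 0 := congrArg Subtype.val h
  change ⁅(c : g), x⁆ = 0
  rw [← lie_skew, h', neg_zero]

open Classical in
theorem exists_pos_nat_of_notMem_diagRoots
    (hz : ∀ α ∈ b.support, (α.1 : H → ℂ) z = if α ∈ D then 0 else 1) {α : H.root}
    (hα : b.IsPos α) (hαD : α ∉ diagRoots H D) : ∃ n : ℕ, (α.1 : H → ℂ) z = n + 1 := by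
  obtain ⟨n, hn⟩ := exists_nat_of_isPos hz hα
  cases n with
  | zero => exact absurd (rootSpace_le_diagSubalgebra hz hα (by simpa using hn)).1 hαD
  | succ n => exact ⟨n, by simpa using hn⟩

open Classical in
theorem levi_sup_nPlus_sup_nMinus (hD : D ⊆ (b.support : Set H.root))
    (hz : ∀ α ∈ b.support, (α.1 : H → ℂ) z = if α ∈ D then 0 else 1) :
    (levi H D).toSubmodule ⊔ nPlus b D ⊔ nMinus b D = ⊤ := by
  set T := (levi H D).toSubmodule ⊔ nPlus b D ⊔ nMinus b D
  have hl : ∀ x ∈ levi H D, x ∈ T := fun x hx =>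
    Submodule.mem_sup_left (Submodule.mem_sup_left hx)
  rw [eq_top_iff]
  have h := congrArg LieSubmodule.toSubmodule (cartan_sup_iSup_rootSpace_eq_top (K := ℂ) (H := H))
  rw [LieSubmodule.top_toSubmodule, LieSubmodule.sup_toSubmodule, LieSubmodule.iSup_toSubmodule]
    at h
  rw [← h]
  refine sup_le (fun x hx => hl x (mem_levi.2 (Submodule.mem_sup_right hx))) (iSup_le fun α => ?_)
  rw [LieSubmodule.iSup_toSubmodule]
  refine iSup_le fun hα x hx => ?_
  obtain ⟨α, rfl⟩ : ∃ α' : H.root, α'.1 = α := ⟨⟨α, by simpa using hα⟩, rfl⟩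
  by_cases hpos : b.IsPos α
  · by_cases hαD : α ∈ diagRoots H D
    · exact hl x (mem_levi.2 (Submodule.mem_sup_left (hαD x hx)))
    · exact Submodule.mem_sup_left (Submodule.mem_sup_right
        (Submodule.subset_span ⟨α, hpos, hαD, hx⟩))
  · obtain ⟨β, hβ, hβpos⟩ := root_neg_index (b := b) α
    have hx' : x ∈ rootSpace H (-(β.1 : H → ℂ)) := by rw [hβ, neg_neg]; exact hx
    by_cases hβD : β ∈ diagRoots H D
    -- Membership of `g_β` in `g_D` has to be transferred to `g_{-β}`: since `z` centralises `g_D`,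
    -- it forces `β` to vanish at `z`, a condition symmetric in sign.
    · obtain ⟨y, hy, hy0⟩ := β.1.exists_ne_zero
      have h0 := lie_diagSubalgebra_eq_zero hD hz (hβD y hy)
      rw [lie_eq_smul_of_rootSpace hy] at h0
      have hβ0 := (smul_eq_zero.1 h0).resolve_right hy0
      exact hl x (mem_levi.2 (Submodule.mem_sup_left
        ((rootSpace_le_diagSubalgebra hz (hβpos.2 hpos) hβ0).2 x hx')))
    · exact Submodule.mem_sup_right (Submodule.subset_span ⟨β, hβpos.2 hpos, hβD, hx'⟩)

end Roots

/-! ### The retraction onto the Levi part and the decomposition of invariants -/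

section Projection

variable {g : Type*} [LieRing g] [LieAlgebra ℂ g] [FiniteDimensional ℂ g]
  [LieAlgebra.IsSemisimple ℂ g] {H : LieSubalgebra ℂ g} [H.IsCartanSubalgebra]
  {b : (rootSystem H).Base} {D : Set H.root}

theorem inclTensor_mem_invariants {k : ℕ} (t : UTensor k (levi H D)) :
    inclTensor k (levi H D) t ∈ invariants k (leviCenter H D) := by
  have h : (inclTensor k (levi H D)).range ≤ invariants k (leviCenter H D) := by
    rw [range_inclTensor]
    refine Algebra.adjoin_le ?_
    rintro _ ⟨i, x, hx, rfl⟩ c hc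
    rw [adAct, diagonal, LinearMap.sum_apply, commutator_diag slot_lie slot_comm,
      lie_eq_zero_of_mem_leviCenter hc hx, map_zero]
  exact h ⟨t, rfl⟩

theorem diagonal_mem_invariants {k : ℕ} {x : g} (hx : x ∈ levi H D) :
    diagonal k x ∈ invariants k (leviCenter H D) := by
  have := inclTensor_mem_invariants (k := k) (diagonal k (⟨x, hx⟩ : levi H D))
  rwa [inclTensor_diagonal] at this

/-- A linear retraction of `U(l_D)^{⊗ k} → U(g)^{⊗ k}` that annihilates both one-sided ideals,
and the decompositions of the invariants relative to each of them. -/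
theorem exists_tensor_projection (hD : D ⊆ (b.support : Set H.root)) (k : ℕ) :
    ∃ r : UTensor k g →ₗ[ℂ] UTensor k (levi H D),
      (∀ t, r (inclTensor k (levi H D) t) = t) ∧
      (∀ u ∈ leftSum k (nPlus b D), r u = 0) ∧
      (∀ u ∈ rightSum k (nMinus b D), r u = 0) ∧
      (∀ u ∈ invariants k (leviCenter H D),
        u - inclTensor k (levi H D) (r u) ∈ leftSum k (nPlus b D) ∧
        u - inclTensor k (levi H D) (r u) ∈ rightSum k (nMinus b D)) := by
  classical
  obtain ⟨z, hz⟩ := exists_grading_element b D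
  have hplus : ∀ α : H.root, b.IsPos α → α ∉ diagRoots H D → ∀ x ∈ rootSpace H (α.1 : H → ℂ),
      ∃ n : ℕ, ⁅(z : g), x⁆ = ((n : ℂ) + 1) • x := by
    intro α hα hαD x hx
    obtain ⟨n, hn⟩ := exists_pos_nat_of_notMem_diagRoots hz hα hαD
    exact ⟨n, by rw [lie_eq_smul_of_rootSpace hx, hn]⟩
  have hminus : ∀ α : H.root, b.IsPos α → α ∉ diagRoots H D →
      ∀ x ∈ rootSpace H (-(α.1 : H → ℂ)), ∃ n : ℕ, ⁅(z : g), x⁆ = -((n : ℂ) + 1) • x := by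
    intro α hα hαD x hx
    obtain ⟨n, hn⟩ := exists_pos_nat_of_notMem_diagRoots hz hα hαD
    exact ⟨n, by rw [lie_eq_smul_of_rootSpace hx, Pi.neg_apply, hn]⟩
  have htop := levi_sup_nPlus_sup_nMinus hD hz
  have hl : ∀ x ∈ levi H D, ⁅(z : g), x⁆ = 0 := fun x hx => lie_levi_eq_zero hD hz hx
  obtain ⟨r, h1, h2, h3⟩ := exists_env_projection_of_grading (levi H D) hl
    (N := nMinus b D) (Q := nPlus b D) (by
      refine Submodule.span_le.2 ?_
      rintro x ⟨α, hα, hαD, hx⟩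
      obtain ⟨n, hn⟩ := hminus α hα hαD x hx
      refine eigenspace_le_posPart (-(z : g)) n ?_
      rw [Module.End.mem_eigenspace_iff, LieAlgebra.ad_apply, neg_lie, hn, neg_smul, neg_neg])
    (by
      refine Submodule.span_le.2 ?_
      rintro x ⟨α, hα, hαD, hx⟩
      obtain ⟨n, hn⟩ := hplus α hα hαD x hx
      refine eigenspace_le_posPart (z : g) n ?_
      rw [Module.End.mem_eigenspace_iff, LieAlgebra.ad_apply, hn]) htop
  have hr := tensorMap_inclTensor (k := k) h1
  have hleft := fun u hu => tensorMap_leftSum (k := k) (n := nPlus b D) h3 (u := u) hu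
  have hright := fun u hu => tensorMap_rightSum (k := k) (n := nMinus b D) h2 (u := u) hu
  refine ⟨tensorMap k r, hr, hleft, hright, fun u hu => ?_⟩
  -- Of the full `c_D`-invariance only commutation with the single element `z` of `c_D` is needed.
  have hu0 : u ∈ (commEnd ℂ (∑ j : Fin k, slot j (z : g))).eigenspace 0 := by
    rw [mem_eigenspace_commEnd, zero_smul]
    have := hu z (mem_leviCenter hD hz)
    rwa [adAct, diagonal, LinearMap.sum_apply] at this
  have hR := eigenspace_zero_le_sup_rightIdeal slot_lie slot_comm adjoin_genSet_slot htop hl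
    (Submodule.span_mono (by rintro x ⟨α, hα, hαD, hx⟩; exact hplus α hα hαD x hx))
    (Submodule.span_mono (by
      rintro x ⟨α, hα, hαD, hx⟩
      obtain ⟨n, hn⟩ := hminus α hα hαD x hx
      exact ⟨Submodule.subset_span ⟨α, hα, hαD, hx⟩, _, hn⟩)) hu0
  have hL := eigenspace_zero_le_sup_leftIdeal slot_lie slot_comm adjoin_genSet_slot hl
    (N := nMinus b D) (Q := nPlus b D) (by rw [← htop]; ac_rfl)
    (Submodule.span_mono (by rintro x ⟨α, hα, hαD, hx⟩; exact hminus α hα hαD x hx))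
    (Submodule.span_mono (by
      rintro x ⟨α, hα, hαD, hx⟩
      obtain ⟨n, hn⟩ := hplus α hα hαD x hx
      exact ⟨Submodule.subset_span ⟨α, hα, hαD, hx⟩, _, hn⟩)) hu0
  rw [← range_inclTensor, ← leftSum_eq] at hL
  rw [← range_inclTensor, ← rightSum_eq] at hR
  -- Since `r` kills `J`, the component of `u` in `U(l_D)^{⊗ k}` must be `r u`. It is therefore the
  -- same for both ideals.
  have conclude : ∀ J : Submodule ℂ (UTensor k g), (∀ v ∈ J, tensorMap k r v = 0) →
      u ∈ Subalgebra.toSubmodule (inclTensor k (levi H D)).range ⊔ J →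
      u - inclTensor k (levi H D) (tensorMap k r u) ∈ J := by
    intro J hJ hu
    obtain ⟨_, ⟨t, rfl⟩, v, hv, rfl⟩ := Submodule.mem_sup.1 hu
    have e : tensorMap k r (inclTensor k (levi H D) t + v) = t := by
      rw [map_add, hr, hJ v hv, add_zero]
    have e' : inclTensor k (levi H D) t + v - inclTensor k (levi H D)
        (tensorMap k r (inclTensor k (levi H D) t + v)) = v := by
      rw [e, add_sub_cancel_left]
    exact e'.symm ▸ hv
  exact ⟨conclude _ hleft hL, conclude _ hright hR⟩

end Projection

end

end GenHC

/-! ### The generalised Harish-Chandra homomorphism -/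

theorem mainTheorem6 {g : Type*} [LieRing g] [LieAlgebra ℂ g] [FiniteDimensional ℂ g]
    [LieAlgebra.IsSemisimple ℂ g] (H : LieSubalgebra ℂ g) [H.IsCartanSubalgebra]
    (b : (LieAlgebra.IsKilling.rootSystem H).Base) (D : Set H.root)
    (hD : D ⊆ (b.support : Set H.root)) (k : ℕ) (hk : 1 ≤ k) :
    -- (i) `I_k` is also cut out by the right ideal generated by `n_D⁻`
    (GenHC.hcIdeal k b D =
      Subalgebra.toSubmodule (GenHC.invariants k (GenHC.leviCenter H D)) ⊓
        GenHC.rightSum k (GenHC.nMinus b D)) ∧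
    -- (ii) `I_k` is a two-sided ideal of the invariants, stable under `ad l_D`
    ((∀ a ∈ GenHC.invariants k (GenHC.leviCenter H D), ∀ u ∈ GenHC.hcIdeal k b D,
        a * u ∈ GenHC.hcIdeal k b D ∧ u * a ∈ GenHC.hcIdeal k b D) ∧
      (∀ z ∈ GenHC.levi H D, ∀ u ∈ GenHC.hcIdeal k b D,
        GenHC.adAct z u ∈ GenHC.hcIdeal k b D)) ∧
    -- (iii) the invariants are the direct sum of `I_k` and `U(l_D)^{⊗ k}`
    (Function.Injective (GenHC.inclTensor k (GenHC.levi H D)) ∧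
      Disjoint (GenHC.hcIdeal k b D)
        (Subalgebra.toSubmodule (GenHC.inclTensor k (GenHC.levi H D)).range) ∧
      GenHC.hcIdeal k b D ⊔
          Subalgebra.toSubmodule (GenHC.inclTensor k (GenHC.levi H D)).range =
        Subalgebra.toSubmodule (GenHC.invariants k (GenHC.leviCenter H D))) ∧
    -- the resulting projection is an `l_D`-equivariant algebra homomorphism onto `U(l_D)^{⊗ k}`
    (∃! π : GenHC.invariants k (GenHC.leviCenter H D) →ₐ[ℂ] GenHC.UTensor k (GenHC.levi H D),
      (∀ u, π u = 0 ↔ (u : GenHC.UTensor k g) ∈ GenHC.hcIdeal k b D) ∧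
      (∀ t, ∃ ht : GenHC.inclTensor k (GenHC.levi H D) t ∈
          GenHC.invariants k (GenHC.leviCenter H D), π ⟨_, ht⟩ = t) ∧
      (∀ (z : GenHC.levi H D) (u : GenHC.invariants k (GenHC.leviCenter H D)),
        ∃ hu : GenHC.adAct (z : g) (u : GenHC.UTensor k g) ∈
          GenHC.invariants k (GenHC.leviCenter H D),
          π ⟨_, hu⟩ = GenHC.adAct z (π u))) := by
  obtain ⟨r, hr, hleft, hright, hdec⟩ := GenHC.exists_tensor_projection (b := b) hD k
  set inv := GenHC.invariants k (GenHC.leviCenter H D)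
  set I := GenHC.hcIdeal k b D
  set φ := GenHC.inclTensor k (GenHC.levi H D)
  have hφ : ∀ t, φ t ∈ inv := GenHC.inclTensor_mem_invariants
  have hIr : ∀ u ∈ inv, r u = 0 → u ∈ I := fun u hu h0 =>
    ⟨hu, by simpa [h0] using (hdec u hu).1⟩
  have hI0 : ∀ u ∈ I, r u = 0 := fun u hu => hleft u hu.2
  have hIinv : ∀ u ∈ I, u ∈ inv := fun u hu => hu.1
  have hIR : ∀ u ∈ I, u ∈ GenHC.rightSum k (GenHC.nMinus b D) := fun u hu => by
    simpa [hI0 u hu] using (hdec u hu.1).2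
  have hmulL : ∀ a ∈ inv, ∀ u ∈ I, a * u ∈ I := fun a ha u hu => by
    refine ⟨inv.mul_mem ha (hIinv u hu), ?_⟩
    have h := hu.2
    rw [GenHC.leftSum_eq] at h ⊢
    exact GenHC.mul_mem_leftIdeal h a
  -- Right stability is visible only in the description by `n_D⁻`; `r` kills that right ideal too,
  -- which leads back to `I`.
  have hmulR : ∀ a ∈ inv, ∀ u ∈ I, u * a ∈ I := fun a ha u hu => by
    refine hIr _ (mul_mem (hIinv u hu) ha) (hright _ ?_)
    have h := hIR u hu
    rw [GenHC.rightSum_eq] at h ⊢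
    exact GenHC.mul_mem_rightIdeal h a
  have hsub : ∀ u ∈ inv, u - φ (r u) ∈ I := fun u hu =>
    ⟨sub_mem hu (hφ _), (hdec u hu).1⟩
  have hmul : ∀ u ∈ inv, ∀ v ∈ inv, r (u * v) = r u * r v := fun u hu v hv => by
    -- Multiplicativity of `r` on invariants: modulo the two-sided ideal `I`, each element equals
    -- its Levi component.
    have e : u * v - φ (r u * r v) = (u - φ (r u)) * v + φ (r u) * (v - φ (r v)) := by
      rw [map_mul]; noncomm_ring
    have h := hI0 _ (e ▸ add_mem (hmulR v hv _ (hsub u hu)) (hmulL _ (hφ (r u)) _ (hsub v hv)))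
    rwa [map_sub, hr, sub_eq_zero] at h
  have hdiag : ∀ x ∈ GenHC.levi H D, GenHC.diagonal k x ∈ inv := fun x hx =>
    GenHC.diagonal_mem_invariants hx
  have had : ∀ x ∈ GenHC.levi H D, ∀ u ∈ inv, GenHC.adAct x u ∈ inv := fun x hx u hu =>
    sub_mem (mul_mem (hdiag x hx) hu) (mul_mem hu (hdiag x hx))
  refine ⟨?_, ⟨fun a ha u hu => ⟨hmulL a ha u hu, hmulR a ha u hu⟩, fun x hx u hu =>
    sub_mem (hmulL _ (hdiag x hx) u hu) (hmulR _ (hdiag x hx) u hu)⟩, ⟨?_, ?_, ?_⟩, ?_⟩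
  · refine le_antisymm (fun u hu => ⟨hu.1, hIR u hu⟩) fun u hu => ?_
    exact hIr u hu.1 (hright u hu.2)
  · exact Function.LeftInverse.injective hr
  · refine Submodule.disjoint_def.2 ?_
    rintro _ hu ⟨t, rfl⟩
    have h : r (φ t) = 0 := hI0 _ hu
    rw [hr] at h
    change φ t = 0
    rw [h, map_zero]
  · refine le_antisymm (sup_le (fun u hu => hu.1) ?_) fun u hu => ?_
    · rintro _ ⟨t, rfl⟩; exact hφ t
    · exact Submodule.mem_sup.2 ⟨u - φ (r u), hsub u hu, φ (r u), ⟨r u, rfl⟩, sub_add_cancel _ _⟩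
  · let π : inv →ₐ[ℂ] GenHC.UTensor k (GenHC.levi H D) :=
      AlgHom.ofLinearMap (r ∘ₗ (Subalgebra.toSubmodule inv).subtype)
        (by
          change r 1 = 1
          rw [← map_one φ, hr])
        (fun u v => hmul u u.2 v v.2)
    have hπ : ∀ u : inv, π u = r u := fun u => rfl
    refine ⟨π, ⟨fun u => ⟨fun h => hIr u u.2 h, fun h => hI0 u h⟩,
      fun t => ⟨hφ t, hr t⟩, fun x u => ⟨had x x.2 u u.2, ?_⟩⟩, ?_⟩
    -- The adjoint action is the commutator with an element of `U(l_D)^{⊗ k}` fixed by the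
    -- projection, so equivariance follows from multiplicativity.
    · have hx : r (GenHC.diagonal k (x : g)) = GenHC.diagonal k x := by
        rw [← GenHC.inclTensor_diagonal]; exact hr _
      have hX := hdiag (x : g) x.2
      have h1 := hmul (GenHC.diagonal k (x : g)) hX (u : GenHC.UTensor k g) u.2
      have h2 := hmul (u : GenHC.UTensor k g) u.2 (GenHC.diagonal k (x : g)) hX
      rw [hx] at h1 h2
      refine (map_sub r (GenHC.diagonal k (x : g) * (u : GenHC.UTensor k g))
        ((u : GenHC.UTensor k g) * GenHC.diagonal k (x : g))).trans ?_
      rw [h1, h2]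
      rfl
    -- The kernel and the values on `U(l_D)^{⊗ k}` already determine the map, by the direct sum
    -- decomposition.
    · rintro π' ⟨hker, hid, -⟩
      refine AlgHom.ext fun u => ?_
      obtain ⟨ht, ht'⟩ := hid (r (u : GenHC.UTensor k g))
      let w : inv := ⟨φ (r (u : GenHC.UTensor k g)), ht⟩
      have hw : ((u - w : inv) : GenHC.UTensor k g) ∈ I := by
        rw [Subalgebra.coe_sub]
        exact hsub u u.2
      have h : π' (u - w) = 0 := (hker (u - w)).2 hw
      have h' : π' u - π' w = 0 := (map_sub π' u w).symm.trans h
      rw [hπ]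
      exact (sub_eq_zero.1 h').trans ht'
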